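/- Let $e,h,f\in\mathfrak{sl}_n(\mathbb R)$ form a standard triple, i.e. $[h,e]=2e$, $[h,f]=-2f$, $[e,f]=h\neq 0$. For $x\in\mathfrak{sl}_n(\mathbb R)$ put $$\lim_{\nu\to0^+}\mathrm{SL}_n(\mathbb R)\cdot(\nu x):=\bigcap_{\epsilon>0}\overline{\bigcup_{\nu\in(0,\epsilon)}\mathrm{SL}_n(\mathbb R)\cdot(\nu x)},$$ with the Euclidean closure and the adjoint (conjugation) action. For a nonzero nilpotent $e'\in\mathfrak{sl}_n(\mathbb R)$ let $\mathcal L(e')=\mathcal L(\mathrm{SL}_n(\mathbb R)\cdot e'):=\lim_{\nu\to0^+}\mathrm{SL}_n(\mathbb R)\cdot(\nu h')$ for a standard triple $(h',e',f')$ in $\mathfrak{sl}_n(\mathbb R)$ through $e'$; this does not depend on the choice of the triple (in particular $\mathcal L(e)=\lim_{\nu\to0^+}\mathrm{SL}_n(\mathbb R)\cdot(\nu h)$), nor on the choice of $e'$ in its orbit. For a partition $\Lambda$ of $n$ let $\mathcal O_\Lambda\subset\mathfrak{sl}_n(\mathbb C)$ be the $\mathrm{SL}_n(\mathbb C)$-orbit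 of the nilpotent matrices whose Jordan blocks have sizes the parts of $\Lambda$. A real form of $\mathcal O_\Lambda$ is an $\mathrm{SL}_n(\mathbb R)$-orbit contained in $\mathcal O_\Lambda\cap\mathfrak{sl}_n(\mathbb R)$. Call $e$ even if all eigenvalues of $\mathrm{ad}(h)$ are even integers. Let $\Lambda$ be the partition of $n$ with $\mathrm{SL}_n(\mathbb C)\cdot e=\mathcal O_\Lambda$, and let $\Lambda^0$ and $\Lambda^1$ be the weakly decreasing sequences of the even parts and of the odd parts of $\Lambda$. (a) If $e$ is even, then $$\mathcal L(e)=\overline{\mathcal O_\Lambda\cap\mathfrak{sl}_n(\mathbb R)}=\overline{\mathcal O_\Lambda}\cap\mathfrak{sl}_n(\mathbb R).$$ (b) $e$ is not even if and only if $\Lambda^0\neq\emptyset$ and $\Lambda^1\neq\emptyset$. In this case let $\Lambda^0+\Lambda^1$ be the partition of $n$ obtained by adding the sequences $\Lambda^0$ and $\Lambda^1$ term by term (the shorter one being extended by zeros). Then $\mathcal O_\Lambda$ and $\mathcal O_{\Lambda^0+\Lambda^1}$ have unique real forms $\mathcal O_\Lambda^{\mathbb R}=\mathrm{SL}_n(\mathbb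 R)\cdot e$ and $\mathcal O_{\Lambda^0+\Lambda^1}^{\mathbb R}$, and $$\mathcal L(\mathcal O_\Lambda^{\mathbb R})=\overline{\mathcal O_{\Lambda^0+\Lambda^1}^{\mathbb R}}.$$ In (a) and (b) the equalities hold both with Euclidean closures and with Zariski closures (in $\mathfrak{sl}_n(\mathbb R)$ for subsets of $\mathfrak{sl}_n(\mathbb R)$, in $\mathfrak{sl}_n(\mathbb C)$ for $\mathcal O_\Lambda$). -/

import Mathlib

-- The commutator bracket on matrices.
attribute [local instance] LieRing.ofAssociativeRing

namespace SLOrbit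

noncomputable section

/-- The Lie algebra `𝔰𝔩ₙ(K)` of traceless `n × n` matrices. -/
abbrev sln (n : ℕ) (K : Type*) [CommRing K] : LieSubalgebra K (Matrix (Fin n) (Fin n) K) :=
  LieAlgebra.SpecialLinear.sl (Fin n) K

/-- The adjoint orbit `SLₙ(K) · x`. -/
def adOrbit {n : ℕ} {K : Type*} [CommRing K] (x : sln n K) : Set (sln n K) :=
  {y | ∃ g : Matrix.SpecialLinearGroup (Fin n) K,
    (y : Matrix (Fin n) (Fin n) K) =
      (g : Matrix (Fin n) (Fin n) K) * (x : Matrix (Fin n) (Fin n) K) *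
        ((g⁻¹ : Matrix.SpecialLinearGroup (Fin n) K) : Matrix (Fin n) (Fin n) K)}

theorem mem_sln_iff {n : ℕ} {K : Type*} [CommRing K] (x : Matrix (Fin n) (Fin n) K) :
    x ∈ sln n K ↔ x.trace = 0 :=
  LinearMap.mem_ker

/-- The inclusion `𝔰𝔩ₙ(ℝ) ⊆ 𝔰𝔩ₙ(ℂ)`. -/
def complexify {n : ℕ} (x : sln n ℝ) : sln n ℂ :=
  ⟨(x : Matrix (Fin n) (Fin n) ℝ).map (algebraMap ℝ ℂ), by
    have h := (mem_sln_iff _).1 x.2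
    rw [mem_sln_iff, ← AddMonoidHom.map_trace (algebraMap ℝ ℂ), h, map_zero]⟩

/-- The set of real points `O ∩ 𝔰𝔩ₙ(ℝ)` of a subset `O` of `𝔰𝔩ₙ(ℂ)`. -/
def realPoints {n : ℕ} (O : Set (sln n ℂ)) : Set (sln n ℝ) :=
  {x | complexify x ∈ O}

/-- The real forms of a complex orbit `O`: the `SLₙ(ℝ)`-orbits contained in `O ∩ 𝔰𝔩ₙ(ℝ)`. -/
def realForms {n : ℕ} (O : Set (sln n ℂ)) : Set (Set (sln n ℝ)) :=
  {R | ∃ x ∈ realPoints O, R = adOrbit x}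

/-- Zariski closure in `𝔰𝔩ₙ(K)`: the common zeros of all polynomials in the matrix entries that
vanish on `S`. -/
def zariskiClosure {n : ℕ} {K : Type*} [CommRing K] (S : Set (sln n K)) : Set (sln n K) :=
  {x | ∀ p : MvPolynomial (Fin n × Fin n) K,
    (∀ y ∈ S, MvPolynomial.eval
      (fun ij => (y : Matrix (Fin n) (Fin n) K) ij.1 ij.2) p = 0) →
    MvPolynomial.eval (fun ij => (x : Matrix (Fin n) (Fin n) K) ij.1 ij.2) p = 0}

/-! ### Limits of orbits and the mapping `𝓛` -/

/-- `lim_{ν → 0⁺} SLₙ(ℝ) · (ν x)`, the intersection over `ε > 0` of the closures of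
`⋃_{0 < ν < ε} SLₙ(ℝ) · (ν x)`. -/
def limitOfOrbits {n : ℕ} (x : sln n ℝ) : Set (sln n ℝ) :=
  ⋂ ε : ℝ, ⋂ _ : 0 < ε, closure (⋃ ν ∈ Set.Ioo (0 : ℝ) ε, adOrbit (ν • x))

open Classical in
/-- `𝓛(e)`: the limit of the orbits `SLₙ(ℝ) · (ν h)` for a standard triple `(h, e, f)` through `e`
(all such `h` give the same set), and `𝓛(0) = {0}`. -/
def limitMap {n : ℕ} (e : sln n ℝ) : Set (sln n ℝ) :=
  if e = 0 then {0} else {z | ∃ h f : sln n ℝ, IsSl2Triple h e f ∧ z ∈ limitOfOrbits h}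

/-- `𝓛(R) = 𝓛(e)` for `e` in the nilpotent orbit `R` (all `e ∈ R` give the same set). -/
def limitMapOrbit {n : ℕ} (R : Set (sln n ℝ)) : Set (sln n ℝ) :=
  {z | ∃ e ∈ R, z ∈ limitMap e}

/-- A triple with neutral element `h` is even if all eigenvalues of `ad h` are even integers. -/
def IsEvenNeutral {n : ℕ} (h : sln n ℝ) : Prop :=
  ∀ c : ℝ, Module.End.HasEigenvalue (LieAlgebra.ad ℝ (sln n ℝ) h) c → ∃ k : ℤ, c = 2 * (k : ℝ)

/-! ### Nilpotent orbits and partitions -/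

/-- The nilpotent Jordan block of size `d`. -/
def jordanBlock (K : Type*) [CommRing K] (d : ℕ) : Matrix (Fin d) (Fin d) K :=
  Matrix.of fun i j => if (i : ℕ) + 1 = (j : ℕ) then 1 else 0

theorem jordanBlock_trace (K : Type*) [CommRing K] (d : ℕ) : (jordanBlock K d).trace = 0 := by
  simp [jordanBlock, Matrix.trace]

/-- The parts of a partition in weakly decreasing order. -/
def partsList {n : ℕ} (Λ : n.Partition) : List ℕ := Λ.parts.sort (· ≥ ·)

theorem partsList_sum {n : ℕ} (Λ : n.Partition) :
    ∑ k : Fin (partsList Λ).length, (partsList Λ).get k = n := by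
  rw [← List.sum_ofFn, List.ofFn_get, ← Multiset.sum_coe, partsList, Multiset.sort_eq,
    Λ.parts_sum]

/-- The standard bijection of the blocks' indices with `{0, …, n - 1}`, one block after another. -/
def blockEquiv {n : ℕ} (Λ : n.Partition) :
    (Σ k : Fin (partsList Λ).length, Fin ((partsList Λ).get k)) ≃ Fin n :=
  finSigmaFinEquiv.trans (finCongr (partsList_sum Λ))

/-- The block diagonal matrix whose blocks are the nilpotent Jordan blocks of sizes the parts
of `Λ`. -/
def jordanMatrix {n : ℕ} (Λ : n.Partition) : sln n ℂ :=
  ⟨Matrix.reindex (blockEquiv Λ) (blockEquiv Λ)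
      (Matrix.blockDiagonal' fun k => jordanBlock ℂ ((partsList Λ).get k)), by
    have h : (Matrix.blockDiagonal' fun k : Fin (partsList Λ).length =>
        jordanBlock ℂ ((partsList Λ).get k)).trace = 0 := by
      rw [Matrix.trace_blockDiagonal']
      simp [jordanBlock_trace]
    rw [mem_sln_iff, ← h]
    exact Equiv.sum_comp (blockEquiv Λ).symm fun i =>
      (Matrix.blockDiagonal' fun k : Fin (partsList Λ).length =>
        jordanBlock ℂ ((partsList Λ).get k)) i i⟩

/-- The nilpotent orbit `O_Λ` of `𝔰𝔩ₙ(ℂ)`: the matrices with Jordan block sizes `Λ`. -/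
def nilpotentOrbit {n : ℕ} (Λ : n.Partition) : Set (sln n ℂ) :=
  adOrbit (jordanMatrix Λ)

/-- The even parts of a partition, in weakly decreasing order. -/
def evenParts {n : ℕ} (Λ : n.Partition) : List ℕ := (Λ.parts.filter Even).sort (· ≥ ·)

/-- The odd parts of a partition, in weakly decreasing order. -/
def oddParts {n : ℕ} (Λ : n.Partition) : List ℕ := (Λ.parts.filter Odd).sort (· ≥ ·)

/-- Sum of two sequences term by term, the shorter one being extended by zeros. -/
def termwiseAdd : List ℕ → List ℕ → List ℕ
  | [], l => l
  | a :: l, [] => a :: l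
  | a :: l, b :: m => (a + b) :: termwiseAdd l m

theorem termwiseAdd_sum (l m : List ℕ) : (termwiseAdd l m).sum = l.sum + m.sum := by
  induction l generalizing m with
  | nil => simp [termwiseAdd]
  | cons a l ih =>
    cases m with
    | nil => simp [termwiseAdd]
    | cons b m => simp [termwiseAdd, ih]; omega

theorem termwiseAdd_pos (l m : List ℕ) (hl : ∀ a ∈ l, 0 < a) (hm : ∀ a ∈ m, 0 < a) :
    ∀ a ∈ termwiseAdd l m, 0 < a := by
  induction l generalizing m with
  | nil => simpa [termwiseAdd] using hm
  | cons a l ih =>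
    cases m with
    | nil => simpa [termwiseAdd] using hl
    | cons b m =>
      intro c hc
      simp only [termwiseAdd, List.mem_cons] at hc
      rcases hc with rfl | hc
      · have := hl a (by simp)
        omega
      · exact ih m (fun x hx => hl x (by simp [hx])) (fun x hx => hm x (by simp [hx])) c hc

/-- The partition `Λ⁰ + Λ¹` of `n`: even and odd parts of `Λ` added term by term. -/
def evenAddOdd {n : ℕ} (Λ : n.Partition) : n.Partition where
  parts := (termwiseAdd (evenParts Λ) (oddParts Λ) : Multiset ℕ)
  parts_pos := by
    intro a ha
    refine termwiseAdd_pos _ _ ?_ ?_ a (by simpa using ha)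
    · intro b hb
      exact Λ.parts_pos (Multiset.mem_of_mem_filter ((Multiset.mem_sort _).1 hb))
    · intro b hb
      exact Λ.parts_pos (Multiset.mem_of_mem_filter ((Multiset.mem_sort _).1 hb))
  parts_sum := by
    rw [Multiset.sum_coe, termwiseAdd_sum, ← Multiset.sum_coe, ← Multiset.sum_coe, evenParts,
      oddParts, Multiset.sort_eq, Multiset.sort_eq, ← Multiset.sum_add]
    have h : Λ.parts.filter Odd = Λ.parts.filter fun a => ¬ Even a :=
      Multiset.filter_congr fun a _ => Nat.not_even_iff_odd.symm
    rw [h, Multiset.filter_add_not, Λ.parts_sum]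

end

end SLOrbit

open SLOrbit

/-! Nilpotent matrices are conjugate when their powers have equal ranks (`isConj_of_rank_pow_eq`),
so everything is compared with one set: for a partition M with Jordan matrix J, `rankLocus M` bounds
the rank of each x^k by that of J^k. Label every basis vector by its position in its block. Then
rank J^k counts the labels that are at least k, and the number of labels equal to k decreases weakly
with k. The main tool is `exists_isConj_isStrict`: any x in the locus is conjugate to a y that is
strictly triangular for the labels. It is used twice. For `closures_eq_rankLocus`: on the line from
y to J all matrices are strict, and generically their powers have the ranks of those of J. So x is a
limit of real points of the orbit of M. Rank bounds are polynomial conditions, hence the Euclidean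
and Zariski closures agree with the locus. For `limitOfOrbits_eq_rankLocus`: let h be diagonalizable
with distinct eigenvalues a_k, the multiplicity of a_k being the number of labels k. Then y + ν
diag(a) is conjugate to ν h, which makes x a limit. Conversely, on the orbit of ν h the product of
the z - ν a_i over i < k has rank at most that of J^k. This product tends to x^k, and rank cannot
jump up in a limit. It remains to find M for a neutral h. By the weight filtration the class of h
depends only on Λ (`isConj_neutralMat`), and its eigenvalues are d-1, d-3, ..., 1-d for the parts d.
Such strings are nested when the parities of the d agree and disjoint when they differ. Uniting the
i-th even string with the i-th odd one gives a decreasing chain of sets with cardinalities the parts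
of Λ⁰+Λ¹, so M = Λ⁰+Λ¹ (`exists_labelled_weights`). The element is even exactly when one parity
occurs, and then M = Λ. Otherwise Λ and M both have an odd part. Changing the sign of an odd Jordan
block gives a centralizing matrix of determinant -1, so the real form is unique. -/

namespace SLOrbit

open Module Polynomial

/-! ### Operators acting by scalars on the successive quotients of a flag -/

section Graded

variable {K V : Type*} [Field K] [AddCommGroup V] [Module K V]

/-- The pairs `(T, χ)` such that `T` acts on `F (i + 1) / F i` as multiplication by `χ i`. -/
def gradedScalars (F : ℕ → Submodule K V) (h0 : F 0 = ⊥) (hF : Monotone F) :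
    Subalgebra K (End K V × (ℕ → K)) where
  carrier := {p | ∀ i, ∀ v ∈ F (i + 1), p.1 v - p.2 i • v ∈ F i}
  mul_mem' := by
    rintro ⟨T, χ⟩ ⟨T', χ'⟩ hT hT' i v hv
    have hstab : ∀ j, ∀ w ∈ F j, T w ∈ F j := by
      rintro (_ | j) w hw
      · rw [h0, Submodule.mem_bot] at hw
        simp [hw]
      · have := (F (j + 1)).add_mem (hF j.le_succ (hT j w hw)) ((F (j + 1)).smul_mem (χ j) hw)
        simpa using this
    have := (F i).add_mem (hstab i _ (hT' i v hv)) ((F i).smul_mem (χ' i) (hT i v hv))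
    convert this using 1
    simp [smul_sub, mul_smul, smul_comm (χ i) (χ' i)]
  add_mem' := by
    rintro ⟨T, χ⟩ ⟨T', χ'⟩ hT hT' i v hv
    convert (F i).add_mem (hT i v hv) (hT' i v hv) using 1
    simp [add_smul]
    abel
  algebraMap_mem' := by
    intro r i v _
    simp [Module.algebraMap_end_apply]

theorem mem_gradedScalars {F : ℕ → Submodule K V} {h0 : F 0 = ⊥} {hF : Monotone F}
    {T : End K V} {χ : ℕ → K} :
    (T, χ) ∈ gradedScalars F h0 hF ↔ ∀ i, ∀ v ∈ F (i + 1), T v - χ i • v ∈ F i :=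
  Iff.rfl

/-- An operator acting as zero on the successive quotients of a flag is nilpotent. -/
theorem isNilpotent_of_flag {F : ℕ → Submodule K V} (h0 : F 0 = ⊥) {s : ℕ} (hs : F s = ⊤)
    {S : End K V} (hS : ∀ i, ∀ v ∈ F (i + 1), S v ∈ F i) : IsNilpotent S := by
  have key : ∀ i, ∀ v ∈ F i, (S ^ i) v = 0 := by
    intro i
    induction i with
    | zero =>
      intro v hv
      simpa [h0] using hv
    | succ i ih =>
      intro v hv
      rw [pow_succ, Module.End.mul_apply]
      exact ih _ (hS i v hv)
  exact ⟨s, LinearMap.ext fun v => key s v (hs ▸ Submodule.mem_top)⟩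

/-- Each factor `T - χ i` pushes the flag down by one step, so `s` of them annihilate the whole
space. -/
theorem aeval_nodal_eq_zero {F : ℕ → Submodule K V} (h0 : F 0 = ⊥) {s : ℕ} (hs : F s = ⊤)
    {T : End K V} {χ : ℕ → K} (hT : ∀ i, ∀ v ∈ F (i + 1), T v - χ i • v ∈ F i) :
    aeval T (Lagrange.nodal (Finset.range s) χ) = 0 := by
  have key : ∀ i, ∀ v ∈ F i, aeval T (Lagrange.nodal (Finset.range i) χ) v = 0 := by
    intro i
    induction i with
    | zero =>
      intro v hv
      simpa [h0] using hv
    | succ i ih =>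
      intro v hv
      rw [Finset.range_add_one, Lagrange.nodal_insert_eq_nodal (by simp), mul_comm, map_mul,
        Module.End.mul_apply]
      apply ih
      simpa [Module.algebraMap_end_apply] using hT i v hv
  exact LinearMap.ext fun v => key s v (hs ▸ Submodule.mem_top)

/-- The nodal polynomial kills `T` and divides (X - χ i) times the Lagrange polynomial, whose value
at `T` therefore has its image in the eigenspace of `χ i`. -/
theorem aeval_mul_aeval_basis {F : ℕ → Submodule K V} (h0 : F 0 = ⊥) {s : ℕ} (hs : F s = ⊤)
    {T : End K V} {χ : ℕ → K} (hT : ∀ i, ∀ v ∈ F (i + 1), T v - χ i • v ∈ F i) {i : ℕ}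
    (hi : i ∈ Finset.range s) :
    T * aeval T (Lagrange.basis (Finset.range s) χ i) =
      χ i • aeval T (Lagrange.basis (Finset.range s) χ i) := by
  have hdvd : Lagrange.nodal (Finset.range s) χ ∣
      (X - C (χ i)) * Lagrange.basis (Finset.range s) χ i := by
    refine ⟨C (Lagrange.nodalWeight (Finset.range s) χ i), ?_⟩
    rw [Lagrange.basis_eq_prod_sub_inv_mul_nodal_div hi, ← mul_assoc, mul_comm (X - C (χ i)),
      mul_assoc, EuclideanDomain.mul_div_cancel' (X_sub_C_ne_zero _)
        (Lagrange.X_sub_C_dvd_nodal χ hi), mul_comm]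
  obtain ⟨q, hq⟩ := hdvd
  have h := congrArg (aeval T) hq
  rw [map_mul, map_mul, aeval_nodal_eq_zero h0 hs hT, zero_mul, map_sub, aeval_X, aeval_C,
    sub_mul, sub_eq_zero] at h
  rw [h, Algebra.smul_def]

/-- Two operators acting by the same pairwise distinct scalars on the successive quotients of a
flag are conjugate. -/
theorem exists_unit_intertwining {F : ℕ → Submodule K V} (h0 : F 0 = ⊥) (hF : Monotone F)
    {s : ℕ} (hs : F s = ⊤) {T T' : End K V} {χ : ℕ → K} (hχ : Set.InjOn χ (Finset.range s))
    (hT : ∀ i, ∀ v ∈ F (i + 1), T v - χ i • v ∈ F i)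
    (hT' : ∀ i, ∀ v ∈ F (i + 1), T' v - χ i • v ∈ F i) :
    ∃ g : End K V, IsUnit g ∧ g * T = T' * g := by
  set b := Lagrange.basis (Finset.range s) χ
  set A := gradedScalars F h0 hF
  -- The Lagrange polynomials give the spectral projections of `T` and `T'`, so `g` carries
  -- eigenspaces to eigenspaces. On the i-th quotient it acts as the sum of the squares of their
  -- values at `χ i`, which is 1, so `g` is unipotent.
  set g : End K V := ∑ i ∈ Finset.range s, aeval T' (b i) * aeval T (b i) with hg
  have hmem : ∀ {S : End K V}, (S, χ) ∈ A → ∀ p : K[X], (aeval S p, fun i => p.eval (χ i)) ∈ A := by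
    intro S hS p
    have h : aeval (S, χ) p ∈ A :=
      Algebra.adjoin_le (Set.singleton_subset_iff.2 hS) (aeval_mem_adjoin_singleton K (S, χ))
    rw [aeval_prod_apply, aeval_pi_apply] at h
    simpa using h
  have hgA : (g, ∑ i ∈ Finset.range s, (fun j => (b i).eval (χ j)) * fun j => (b i).eval (χ j)) ∈
      A := by
    have h := A.sum_mem fun i (_ : i ∈ Finset.range s) => A.mul_mem
      (hmem (mem_gradedScalars.2 hT') (b i)) (hmem (mem_gradedScalars.2 hT) (b i))
    convert h using 1
    ext1 <;> simp [hg, Prod.fst_sum, Prod.snd_sum]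
  have hnil : IsNilpotent (g - 1) := by
    refine isNilpotent_of_flag h0 hs fun i v hv => ?_
    rcases lt_or_ge i s with hi | hi
    · have h := mem_gradedScalars.1 hgA i v hv
      have hone : (∑ k ∈ Finset.range s, (fun j => (b k).eval (χ j)) * fun j => (b k).eval (χ j)) i
          = 1 := by
        have hi' : i ∈ Finset.range s := Finset.mem_range.2 hi
        rw [Finset.sum_apply, Finset.sum_eq_single_of_mem i hi']
        · simp [b, Lagrange.eval_basis_self hχ hi']
        · intro k _ hki
          simp [b, Lagrange.eval_basis_of_ne hki hi']
      rw [hone, one_smul] at h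
      simpa using h
    · have : F i = ⊤ := top_le_iff.1 (hs ▸ hF hi)
      simp [this]
  refine ⟨g, by simpa using hnil.isUnit_one_add, ?_⟩
  rw [hg, Finset.sum_mul, Finset.mul_sum]
  refine Finset.sum_congr rfl fun i hi => ?_
  have hcomm : Commute (aeval T (b i)) T := by
    simpa using (Commute.all (b i) X).map (aeval T)
  rw [← mul_assoc, aeval_mul_aeval_basis h0 hs hT' hi, mul_assoc, hcomm.eq,
    aeval_mul_aeval_basis h0 hs hT hi, mul_smul_comm, smul_mul_assoc]

end Graded

/-! ### Extending linear maps along subspaces -/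

section Extend

variable {K V W : Type*} [Field K] [AddCommGroup V] [Module K V] [AddCommGroup W] [Module K W]

theorem exists_linearMap_of_disjoint {I C : Submodule K V} (hIC : Disjoint I C) (f k : V →ₗ[K] W) :
    ∃ G : V →ₗ[K] W, (∀ v ∈ I, G v = f v) ∧ ∀ v ∈ C, G v = k v := by
  obtain ⟨Q, hQ, hC⟩ := hIC.exists_isCompl
  refine ⟨f ∘ₗ Q.projection C hC + k ∘ₗ (LinearMap.id - Q.projection C hC), fun v hv => ?_,
    fun v hv => ?_⟩
  · simp [Submodule.projection_apply_of_mem_left hC (hQ hv)]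
  · simp [Submodule.projection_apply_of_mem_right hC hv]

theorem finrank_map_add_finrank_inf_ker [FiniteDimensional K V] (f : V →ₗ[K] W)
    (S : Submodule K V) : finrank K (S.map f) + finrank K (S ⊓ f.ker : Submodule K V) =
      finrank K S := by
  have h := (f.domRestrict S).finrank_range_add_finrank_ker
  rw [LinearMap.range_domRestrict] at h
  have hk : (f.domRestrict S).ker.map S.subtype = S ⊓ f.ker := by
    rw [LinearMap.ker_domRestrict, Submodule.map_comap_subtype]
  rwa [← Submodule.finrank_map_subtype_eq, hk] at h

variable [FiniteDimensional K V] [FiniteDimensional K W]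

/-- A linear map which is injective from `A ≤ B` to `A' ≤ B'` can be changed away from `I`, where
`I ⊓ B ≤ A`, to a map which is injective from `B` to `B'`. -/
theorem exists_linearMap_injective_on {I A B : Submodule K V} {A' B' : Submodule K W}
    (hAB : A ≤ B) (hAB' : A' ≤ B') (hAI : A ≤ I) (hI : I ⊓ B ≤ A)
    (hA : finrank K A = finrank K A') (hB : finrank K B = finrank K B') (f : V →ₗ[K] W)
    (hf : ∀ v ∈ A, f v ∈ A') (hf0 : ∀ v ∈ A, f v = 0 → v = 0) :
    ∃ G : V →ₗ[K] W, (∀ v ∈ I, G v = f v) ∧ (∀ v ∈ B, G v ∈ B') ∧ ∀ v ∈ B, G v = 0 → v = 0 := by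
  obtain ⟨C, hC⟩ := IsModularLattice.exists_disjoint_and_sup_eq hAB
  obtain ⟨C', hC'⟩ := IsModularLattice.exists_disjoint_and_sup_eq hAB'
  have hd := Submodule.finrank_sup_add_finrank_inf_eq A C
  have hd' := Submodule.finrank_sup_add_finrank_inf_eq A' C'
  rw [hC.1.eq_bot, hC.2, finrank_bot] at hd
  rw [hC'.1.eq_bot, hC'.2, finrank_bot] at hd'
  -- On `A` the map `f` is kept; the complements `C` and `C'` are matched arbitrarily. The
  -- hypothesis on `I` makes `I` and `C` disjoint, so the two prescriptions do not conflict.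
  have κ : C ≃ₗ[K] C' := LinearEquiv.ofFinrankEq _ _ (by omega)
  obtain ⟨k, hk⟩ := LinearMap.exists_extend (C'.subtype ∘ₗ κ.toLinearMap)
  have hk' : ∀ c : C, k c = κ c := fun c => LinearMap.congr_fun hk c
  have hCB : C ≤ B := hC.2 ▸ le_sup_right
  have hCB' : C' ≤ B' := hC'.2 ▸ le_sup_right
  have hIC : Disjoint I C := by
    rw [disjoint_iff_inf_le, ← hC.1.eq_bot]
    exact le_inf ((inf_le_inf_left I hCB).trans hI) inf_le_right
  obtain ⟨G, hGI, hGC⟩ := exists_linearMap_of_disjoint hIC f k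
  have hG : ∀ v ∈ B, ∃ a ∈ A, ∃ c : C, v = a + c ∧ G v = f a + κ c := by
    intro v hv
    rw [← hC.2] at hv
    obtain ⟨a, ha, c, hc, rfl⟩ := Submodule.mem_sup.1 hv
    exact ⟨a, ha, ⟨c, hc⟩, rfl, by rw [map_add, hGI a (hAI ha), hGC c hc, ← hk']⟩
  refine ⟨G, hGI, fun v hv => ?_, fun v hv h0 => ?_⟩
  · obtain ⟨a, ha, c, -, h⟩ := hG v hv
    rw [h]
    exact B'.add_mem (hAB' (hf a ha)) (hCB' (κ c).2)
  · obtain ⟨a, ha, c, rfl, h⟩ := hG v hv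
    rw [h0] at h
    have h1 : f a = 0 := by
      refine Submodule.disjoint_def.1 hC'.1 _ (hf a ha) ?_
      rw [eq_neg_of_add_eq_zero_left h.symm]
      exact C'.neg_mem (κ c).2
    rw [h1, zero_add] at h
    have h2 : c = 0 := by simpa using h.symm
    rw [hf0 a ha h1, h2]
    simp

/-- Two flags with the same dimensions are exchanged by a linear map. -/
theorem exists_linearMap_map_flag {U : ℕ → Submodule K V} {U' : ℕ → Submodule K W}
    (h0 : U 0 = ⊥) (hU : Monotone U) (hU' : Monotone U') (s : ℕ)
    (h : ∀ i ≤ s, finrank K (U i) = finrank K (U' i)) :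
    ∃ g : V →ₗ[K] W, (∀ i ≤ s, ∀ v ∈ U i, g v ∈ U' i) ∧ ∀ v ∈ U s, g v = 0 → v = 0 := by
  induction s with
  | zero =>
    refine ⟨0, fun i _ v _ => by simp, fun v hv _ => by simpa [h0] using hv⟩
  | succ s ih =>
    obtain ⟨g, hg, hg0⟩ := ih fun i hi => h i (by omega)
    obtain ⟨G, hG, hGB, hG0⟩ := exists_linearMap_injective_on (hU s.le_succ) (hU' s.le_succ)
      le_rfl inf_le_left (h s (by omega)) (h (s + 1) le_rfl) g (hg s le_rfl) hg0
    refine ⟨G, fun i hi v hv => ?_, hG0⟩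
    rcases hi.lt_or_eq with hi | rfl
    · rw [hG v (hU (Nat.lt_succ_iff.1 hi) hv)]
      exact hg i (by omega) v hv
    · exact hGB v hv

end Extend

/-! ### Nilpotent operators are classified by the ranks of their powers -/

section Nilpotent

variable {K : Type*} [Field K]

theorem range_pow_succ {V : Type*} [AddCommGroup V] [Module K V] (x : End K V) (k : ℕ) :
    (x ^ (k + 1)).range = x.range.map (x ^ k) := by
  rw [pow_succ, Module.End.mul_eq_comp, LinearMap.range_comp]

/-- The restriction of an operator to its range. -/
def restrictRange {V : Type*} [AddCommGroup V] [Module K V] (x : End K V) : End K x.range :=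
  x.restrict fun v _ => LinearMap.mem_range_self x v

theorem coe_restrictRange_pow {V : Type*} [AddCommGroup V] [Module K V] (x : End K V) (k : ℕ)
    (v : x.range) : ((restrictRange x ^ k) v : V) = (x ^ k) v := by
  rw [restrictRange, Module.End.pow_restrict]
  rfl

theorem finrank_range_restrictRange_pow {V : Type*} [AddCommGroup V] [Module K V]
    (x : End K V) (k : ℕ) :
    finrank K (restrictRange x ^ k).range = finrank K (x ^ (k + 1)).range := by
  rw [← Submodule.finrank_map_subtype_eq, range_pow_succ, ← LinearMap.range_comp]
  have h : x.range.subtype ∘ₗ (restrictRange x ^ k) = (x ^ k) ∘ₗ x.range.subtype :=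
    LinearMap.ext (coe_restrictRange_pow x k)
  rw [h, LinearMap.range_comp, Submodule.range_subtype]

/-- Nilpotent operators whose powers have the same ranks are conjugate. -/
theorem exists_equiv_of_finrank_range_pow_eq {V W : Type*} [AddCommGroup V] [Module K V]
    [FiniteDimensional K V] [AddCommGroup W] [Module K W] [FiniteDimensional K W] (N : ℕ)
    (x : End K V) (y : End K W) (hx : x ^ N = 0)
    (h : ∀ k, finrank K (x ^ k).range = finrank K (y ^ k).range) :
    ∃ g : V ≃ₗ[K] W, ∀ v, g (x v) = y (g v) := by
  have hVW : finrank K V = finrank K W := by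
    have h0 := h 0
    rwa [pow_zero, pow_zero, Module.End.one_eq_id, Module.End.one_eq_id, LinearMap.range_id,
      LinearMap.range_id, finrank_top, finrank_top] at h0
  induction N generalizing V W with
  | zero =>
    have hV : ∀ v : V, v = 0 := fun v => by simpa using LinearMap.congr_fun hx v
    have e := LinearEquiv.ofFinrankEq V W hVW
    have hW : ∀ w : W, w = 0 := fun w => by rw [← e.apply_symm_apply w, hV (e.symm w), map_zero]
    exact ⟨e, fun v => by rw [hW (e _), hW (y _)]⟩
  | succ N ih =>
    have h1 : finrank K x.range = finrank K y.range := by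
      have h1 := h 1
      rwa [pow_one, pow_one] at h1
    obtain ⟨g₀, hg₀⟩ := ih (restrictRange x) (restrictRange y)
      (LinearMap.ext fun v => Subtype.ext <| by
        obtain ⟨_, w, rfl⟩ := v
        rw [coe_restrictRange_pow]
        simpa [pow_succ] using LinearMap.congr_fun hx w)
      (fun k => by rw [finrank_range_restrictRange_pow, finrank_range_restrictRange_pow, h]) h1
    obtain ⟨f, hf⟩ := LinearMap.exists_extend (y.range.subtype ∘ₗ g₀.toLinearMap)
    have hf' : ∀ v : x.range, f v = g₀ v := fun v => LinearMap.congr_fun hf v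
    have hfx : ∀ v ∈ x.range, y (f v) = f (x v) := fun v hv => by
      rw [hf' ⟨v, hv⟩]
      refine (congrArg Subtype.val (hg₀ ⟨v, hv⟩)).symm.trans ?_
      exact (hf' (restrictRange x ⟨v, hv⟩)).symm
    have hf0 : ∀ v ∈ x.range, f v = 0 → v = 0 := fun v hv h0 => by
      rw [hf' ⟨v, hv⟩] at h0
      simpa using h0
    have hfr : ∀ v ∈ x.range, f v ∈ y.range := fun v hv => by
      rw [hf' ⟨v, hv⟩]
      exact (g₀ ⟨v, hv⟩).2
    have hkx := x.finrank_range_add_finrank_ker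
    have hky := y.finrank_range_add_finrank_ker
    have hx2 := finrank_map_add_finrank_inf_ker x x.range
    have hy2 := finrank_map_add_finrank_inf_ker y y.range
    have h2 := h 2
    rw [range_pow_succ, range_pow_succ, pow_one, pow_one] at h2
    -- The ranks of `x` and `x ^ 2` determine the dimensions of the kernel and of its intersection
    -- with the range. So `f` can be altered away from the range until it embeds ker x in ker y.
    obtain ⟨G, hG, hGk, hG0⟩ := exists_linearMap_injective_on (I := x.range)
      (inf_le_right : x.range ⊓ x.ker ≤ x.ker) (inf_le_right : y.range ⊓ y.ker ≤ y.ker)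
      inf_le_left le_rfl (by omega) (by omega) f
      (fun v hv => ⟨hfr v hv.1, by
        refine LinearMap.mem_ker.2 ?_
        rw [hfx v hv.1, LinearMap.mem_ker.1 hv.2, map_zero]⟩)
      (fun v hv => hf0 v hv.1)
    obtain ⟨t, ht⟩ := y.rangeRestrict.exists_rightInverse_of_surjective y.range_rangeRestrict
    obtain ⟨T, hT⟩ := LinearMap.exists_extend t
    have hyT : ∀ w ∈ y.range, y (T w) = w := fun w hw => by
      have h1 : T w = t ⟨w, hw⟩ := LinearMap.congr_fun hT ⟨w, hw⟩
      rw [h1]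
      exact congrArg Subtype.val (LinearMap.congr_fun ht ⟨w, hw⟩)
    -- `T` is a section of `y` over its range. Subtracting `T` of the defect forces `y ∘ g = f ∘ x`.
    -- The defect vanishes on the range and on the kernel of `x`, so `g` is still `f` on the former
    -- and injective on the latter.
    set g : V →ₗ[K] W := G - T ∘ₗ (y ∘ₗ G - f ∘ₗ x) with hg
    have hgv : ∀ v, g v = G v - T (y (G v) - f (x v)) := fun v => rfl
    have hgx : ∀ v ∈ x.range, g v = f v := fun v hv => by
      rw [hgv, hG v hv, hfx v hv, sub_self, map_zero, sub_zero]
    have hyg : ∀ v, y (g v) = f (x v) := fun v => by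
      rw [hgv, map_sub, hyT _ (y.range.sub_mem ⟨_, rfl⟩ (hfr _ ⟨_, rfl⟩)), sub_sub_cancel]
    have hinj : Function.Injective g := by
      rw [injective_iff_map_eq_zero]
      intro v hv
      have hxv : x v = 0 := hf0 _ ⟨v, rfl⟩ (by rw [← hyg, hv, map_zero])
      refine hG0 v (LinearMap.mem_ker.2 hxv) ?_
      have hGv : y (G v) = 0 := LinearMap.mem_ker.1 (hGk v (LinearMap.mem_ker.2 hxv))
      rwa [hgv, hGv, hxv, map_zero, sub_zero, map_zero, sub_zero] at hv
    refine ⟨g.linearEquivOfInjective hinj hVW, fun v => ?_⟩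
    rw [LinearMap.linearEquivOfInjective_apply, LinearMap.linearEquivOfInjective_apply, hyg,
      hgx _ ⟨v, rfl⟩]

end Nilpotent

/-! ### Flags on which a nilpotent operator is strictly triangular -/

section StrictFlag

variable {K : Type*} [Field K]

theorem exists_between_finrank_eq {V : Type*} [AddCommGroup V] [Module K V] [FiniteDimensional K V]
    {A B : Submodule K V} (hAB : A ≤ B) {m : ℕ} (hA : finrank K A ≤ m) (hB : m ≤ finrank K B) :
    ∃ C, A ≤ C ∧ C ≤ B ∧ finrank K C = m := by
  induction m, hA using Nat.le_induction with
  | base => exact ⟨A, le_rfl, hAB, rfl⟩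
  | succ m _ ih =>
    obtain ⟨C, hAC, hCB, hC⟩ := ih (by omega)
    obtain ⟨v, hvB, hvC⟩ := SetLike.exists_of_lt
      (lt_of_le_of_ne hCB fun h => by rw [h] at hC; omega)
    refine ⟨C ⊔ K ∙ v, hAC.trans le_sup_left, sup_le hCB ?_, le_antisymm ?_ ?_⟩
    · rwa [Submodule.span_singleton_le_iff_mem]
    · have h1 := Submodule.finrank_add_le_finrank_add_finrank C (K ∙ v)
      have h2 : finrank K (K ∙ v) ≤ 1 := by
        simpa using finrank_span_le_card (R := K) ({v} : Set V)
      omega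
    · have : C < C ⊔ K ∙ v := by
        refine lt_of_le_of_ne le_sup_left fun h => hvC ?_
        rw [h]
        exact Submodule.mem_sup_right (Submodule.mem_span_singleton_self v)
      have := Submodule.finrank_lt_finrank_of_lt this
      omega

/-- In a decreasing chain `A` of subspaces reaching zero, a subspace of `A 0` of given dimension
can be chosen to be comparable with all members of the chain. -/
theorem exists_comparable_finrank_eq {V : Type*} [AddCommGroup V] [Module K V]
    [FiniteDimensional K V] {A : ℕ → Submodule K V} (hA : Antitone A) {N : ℕ} (hN : A N = ⊥)
    {m : ℕ} (hm : m ≤ finrank K (A 0)) :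
    ∃ C, C ≤ A 0 ∧ finrank K C = m ∧ ∀ k, C ≤ A k ∨ A k ≤ C := by
  classical
  have hex : ∃ k, finrank K (A k) ≤ m := ⟨N, by rw [hN, finrank_bot]; exact m.zero_le⟩
  -- A subspace squeezed between the first member of dimension at most `m` and its predecessor is
  -- comparable with the whole chain.
  obtain ⟨k, hk, hmin⟩ : ∃ k, finrank K (A k) ≤ m ∧ ∀ j < k, m < finrank K (A j) :=
    ⟨Nat.find hex, Nat.find_spec hex, fun j hj => not_le.1 (Nat.find_min hex hj)⟩
  rcases k with _ | k
  · exact ⟨A 0, le_rfl, le_antisymm hk hm, fun k => Or.inr (hA k.zero_le)⟩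
  · obtain ⟨C, h1, h2, h3⟩ := exists_between_finrank_eq (hA k.le_succ) hk
      (hmin k k.lt_succ_self).le
    refine ⟨C, h2.trans (hA k.zero_le), h3, fun j => ?_⟩
    rcases le_or_gt j k with hj | hj
    · exact Or.inl (h2.trans (hA hj))
    · exact Or.inr ((hA hj).trans h1)

theorem finrank_comap_mkQ {V : Type*} [AddCommGroup V] [Module K V] [FiniteDimensional K V]
    (C : Submodule K V) (U : Submodule K (V ⧸ C)) :
    finrank K (U.comap C.mkQ) = finrank K C + finrank K U := by
  have h := finrank_map_add_finrank_inf_ker C.mkQ (U.comap C.mkQ)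
  rw [Submodule.map_comap_eq_of_surjective C.mkQ_surjective, Submodule.ker_mkQ,
    inf_eq_right.2 (by simpa using Submodule.comap_mono (f := C.mkQ) (bot_le : ⊥ ≤ U))] at h
  omega

theorem range_mapQ_pow {V : Type*} [AddCommGroup V] [Module K V] {C : Submodule K V} {x : End K V}
    (hC : C ≤ C.comap x) (k : ℕ) : ((C.mapQ C x hC : End K (V ⧸ C)) ^ k).range =
      (x ^ k).range.map C.mkQ := by
  have h : (C.mapQ C x hC ^ k) ∘ₗ C.mkQ = C.mkQ ∘ₗ (x ^ k) := by
    induction k with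
    | zero => rfl
    | succ k ih =>
      rw [pow_succ', pow_succ', Module.End.mul_eq_comp, Module.End.mul_eq_comp,
        LinearMap.comp_assoc, ih, ← LinearMap.comp_assoc, ← LinearMap.comp_assoc]
      rfl
  rw [← LinearMap.range_comp, ← h, LinearMap.range_comp_of_range_eq_top _ C.range_mkQ]

/-- If the ranks of the powers of `x` are at most those allowed by a weakly decreasing sequence `m`
of dimensions, then `x` is strictly triangular with respect to a flag with jumps `m`. -/
theorem exists_strict_flag {V : Type*} [AddCommGroup V] [Module K V] [FiniteDimensional K V]
    (s : ℕ) (x : End K V) {m : ℕ → ℕ} (hm : Antitone m)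
    (hs : ∑ i ∈ Finset.range s, m i = finrank K V)
    (hr : ∀ k ≤ s, finrank K (x ^ k).range + ∑ i ∈ Finset.range k, m i ≤ finrank K V) :
    ∃ U : ℕ → Submodule K V, U 0 = ⊥ ∧ Monotone U ∧
      (∀ i ≤ s, finrank K (U i) = ∑ j ∈ Finset.range i, m j) ∧
      ∀ i < s, U (i + 1) ≤ (U i).comap x := by
  induction s generalizing V m with
  | zero =>
    refine ⟨fun _ => ⊥, rfl, monotone_const, fun i hi => ?_, fun i hi => absurd hi i.not_lt_zero⟩
    simp [Nat.le_zero.1 hi]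
  | succ s ih =>
    have hanti : Antitone fun k => x.ker ⊓ (x ^ k).range := fun a b hab =>
      inf_le_inf_left _ <| by
        rw [← Nat.add_sub_cancel' hab, pow_add, Module.End.mul_eq_comp]
        exact LinearMap.range_comp_le_range _ _
    have hbot : (x ^ (s + 1)).range = ⊥ := by
      have := hr (s + 1) le_rfl
      rw [hs] at this
      exact Submodule.finrank_eq_zero.1 (by omega)
    -- `C` is the first step of the flag; the rest comes from the quotient by `C`. Comparability
    -- with the subspaces ker x ∩ im x^k makes the ranks on that quotient computable.
    obtain ⟨C, hCx, hCm, hC⟩ := exists_comparable_finrank_eq hanti (N := s + 1) (m := m 0)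
      (by rw [hbot, inf_bot_eq]) (by
        have h1 := hr 1 (by omega)
        have h2 := x.finrank_range_add_finrank_ker
        have h3 : x.ker ⊓ (x ^ 0).range = x.ker := by
          rw [pow_zero, Module.End.one_eq_id, LinearMap.range_id, inf_top_eq]
        change m 0 ≤ finrank K (x.ker ⊓ (x ^ 0).range : Submodule K V)
        rw [h3]
        rw [pow_one, Finset.sum_range_one] at h1
        omega)
    have hCk : C ≤ x.ker := hCx.trans inf_le_left
    have hCC : C ≤ C.comap x := fun v hv => by
      simp [LinearMap.mem_ker.1 (hCk hv)]
    have hq := Submodule.finrank_quotient_add_finrank C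
    rw [Finset.sum_range_succ'] at hs
    obtain ⟨U, hU0, hUm, hUd, hUx⟩ := ih (C.mapQ C x hCC) (m := fun i => m (i + 1))
      (fun a b hab => hm (by omega)) (by omega) (fun k hk => by
        have h1 := hr (k + 1) (by omega)
        have h2 := finrank_map_add_finrank_inf_ker C.mkQ (x ^ k).range
        rw [Finset.sum_range_succ'] at h1
        rw [range_mapQ_pow]
        rw [Submodule.ker_mkQ] at h2
        -- If `C` lies in im x^k, the rank drops by exactly `m 0`, and the bound at `k` suffices
        -- because `m` decreases. Otherwise `C` meets im x^k in ker x ∩ im x^k, so the quotient rank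
        -- is that of x^(k+1), bounded at `k + 1`.
        rcases hC k with h | h
        · have h3 : (x ^ k).range ⊓ C = C := inf_eq_right.2 (h.trans inf_le_right)
          have h4 := hr k (by omega)
          have h5 : ∑ i ∈ Finset.range k, m (i + 1) ≤ ∑ i ∈ Finset.range k, m i :=
            Finset.sum_le_sum fun i _ => hm i.le_succ
          rw [h3] at h2
          omega
        · have h3 : x.ker ⊓ (x ^ k).range = (x ^ k).range ⊓ C :=
            le_antisymm (le_inf inf_le_right h) (le_inf (inf_le_right.trans hCk) inf_le_left)
          have h4 := finrank_map_add_finrank_inf_ker x (x ^ k).range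
          rw [inf_comm, h3, ← LinearMap.range_comp, ← Module.End.mul_eq_comp, ← pow_succ'] at h4
          omega)
    refine ⟨fun i => i.casesOn ⊥ fun i => (U i).comap C.mkQ, rfl, ?_, ?_, ?_⟩
    · refine monotone_nat_of_le_succ fun i => ?_
      rcases i with _ | i
      · exact bot_le
      · exact Submodule.comap_mono (hUm i.le_succ)
    · rintro (_ | i) hi
      · simp
      · rw [Finset.sum_range_succ', ← hUd i (by omega), ← hCm, add_comm (finrank K (U i))]
        exact finrank_comap_mkQ C (U i)
    · rintro (_ | i) hi v hv
      · have hv' : C.mkQ v ∈ U 0 := hv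
        rw [hU0, Submodule.mem_bot, Submodule.mkQ_apply, Submodule.Quotient.mk_eq_zero] at hv'
        exact hCk hv'
      · exact hUx i (by omega) hv

end StrictFlag

/-! ### The weight filtration of the nilpotent element of a standard triple -/

section WeightFiltration

theorem neutral_mul_pow {R : Type*} [Ring R] {h e : R} (hhe : h * e = e * h + 2 * e) (m : ℕ) :
    h * e ^ m = e ^ m * h + 2 * m * e ^ m := by
  induction m with
  | zero => simp
  | succ m ih =>
    rw [pow_succ, ← mul_assoc, ih, add_mul, mul_assoc, hhe]
    push_cast
    noncomm_ring

theorem pow_succ_mul_eq {R : Type*} [Ring R] {h e f : R} (hhe : h * e = e * h + 2 * e)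
    (hef : e * f = f * e + h) (m : ℕ) :
    e ^ (m + 1) * f = f * e ^ (m + 1) + (m + 1) * (e ^ m * (h + m)) := by
  induction m with
  | zero => simp [hef]
  | succ m ih =>
    rw [pow_succ', mul_assoc, ih, mul_add, ← mul_assoc, hef, add_mul, neutral_mul_pow hhe]
    push_cast
    simp only [Nat.cast_comm, mul_add, add_mul, mul_assoc, pow_succ', one_mul, mul_one]
    noncomm_ring

variable {K V : Type*} [Field K] [AddCommGroup V] [Module K V]

/-- The weight filtration of `e`: the sum of the `im e ^ a ∩ ker e ^ b` with `c ≤ a - b`. -/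
def weightFiltration (e : End K V) (c : ℤ) : Submodule K V :=
  ⨆ (a : ℕ) (b : ℕ) (_ : c ≤ (a : ℤ) - b), (e ^ a).range ⊓ (e ^ b).ker

theorem le_weightFiltration (e : End K V) {a b : ℕ} {c : ℤ} (h : c ≤ (a : ℤ) - b) :
    (e ^ a).range ⊓ (e ^ b).ker ≤ weightFiltration e c :=
  le_iSup_of_le a <| le_iSup_of_le b <| le_iSup_of_le h le_rfl

theorem weightFiltration_antitone (e : End K V) : Antitone (weightFiltration e) :=
  fun _ _ h => iSup_le fun _ => iSup_le fun _ => iSup_le fun h' =>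
    le_weightFiltration e (h.trans h')

theorem weightFiltration_eq_bot {e : End K V} {N : ℕ} (he : e ^ N = 0) :
    weightFiltration e N = ⊥ := by
  refine le_bot_iff.1 <| iSup_le fun a => iSup_le fun b => iSup_le fun h => inf_le_left.trans ?_
  rw [← Nat.sub_add_cancel (show N ≤ a by omega), pow_add, he, mul_zero]
  simp

theorem weightFiltration_eq_top {e : End K V} {N : ℕ} (he : e ^ N = 0) :
    weightFiltration e (-N) = ⊤ := by
  refine top_le_iff.1 (le_trans ?_ (le_weightFiltration e (a := 0) (b := N) (by simp)))
  rw [he, pow_zero, Module.End.one_eq_id, LinearMap.range_id, LinearMap.ker_zero, inf_top_eq]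

/-- The neutral element of a standard triple acts on the `c`-th quotient of the weight filtration
of the nilpositive element as multiplication by `c + 1`. -/
theorem sub_smul_mem_weightFiltration [CharZero K] {h e f : End K V} (hhe : h * e = e * h + 2 * e)
    (hef : e * f = f * e + h) (c : ℤ) {v : V} (hv : v ∈ weightFiltration e c) :
    h v - ((c : K) + 1) • v ∈ weightFiltration e (c + 1) := by
  have hh : ∀ (m : ℕ) (u : V), h ((e ^ m) u) = (e ^ m) (h u) + (2 * (m : K)) • (e ^ m) u := by
    intro m u
    have := LinearMap.congr_fun (neutral_mul_pow hhe m) u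
    simp only [Module.End.mul_apply, LinearMap.add_apply, Module.End.natCast_apply,
      Module.End.ofNat_apply] at this
    rw [this, mul_smul, ofNat_smul_eq_nsmul K, Nat.cast_smul_eq_nsmul]
  have hrange : ∀ (a : ℕ) (r : K), ∀ v ∈ (e ^ a).range, h v - r • v ∈ (e ^ a).range := by
    rintro a r _ ⟨u, rfl⟩
    rw [hh]
    exact Submodule.sub_mem _ (Submodule.add_mem _ ⟨_, rfl⟩ (Submodule.smul_mem _ _ ⟨_, rfl⟩))
      (Submodule.smul_mem _ _ ⟨_, rfl⟩)
  have hker : ∀ (b : ℕ) (r : K), ∀ v ∈ (e ^ b).ker, h v - r • v ∈ (e ^ b).ker := by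
    intro b r v hv
    rw [LinearMap.mem_ker] at hv ⊢
    have := hh b v
    rw [hv, map_zero, smul_zero, add_zero] at this
    rw [map_sub, map_smul, hv, ← this, smul_zero, sub_zero]
  suffices weightFiltration e c ≤ (weightFiltration e (c + 1)).comap
      (h - ((c : K) + 1) • LinearMap.id) from this hv
  refine iSup_le fun a => iSup_le fun b => iSup_le fun hab v hv => ?_
  rw [Submodule.mem_comap, LinearMap.sub_apply, LinearMap.smul_apply, LinearMap.id_apply]
  rcases hab.lt_or_eq with hab | hab
  · exact le_weightFiltration e hab ⟨hrange a _ v hv.1, hker b _ v hv.2⟩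
  rcases b with _ | b
  · have : v = 0 := by simpa using hv.2
    simp [this]
  obtain ⟨⟨u, rfl⟩, hu⟩ := hv
  have hc : (c : K) + 1 = a - b := by
    rw [hab]
    push_cast
    ring
  set p := h ((e ^ a) u) - ((c : K) + 1) • (e ^ a) u with hp
  -- Moving `f` past e^(a+b+1), which kills `u`, leaves (a+b+1) e^b p; hence e^b q = e^b p. In p = q
  -- + (p - q) the first term gains one power in the range condition and the second loses one in the
  -- kernel condition, so both lie one step deeper.
  set q := (((a + b : ℕ) : K) + 1)⁻¹ • (e ^ (a + 1)) (f u) with hq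
  have hne : (((a + b : ℕ) : K) + 1) ≠ 0 := Nat.cast_add_one_ne_zero _
  have hu' : (e ^ (a + b + 1)) u = 0 := by
    rw [show a + b + 1 = b + 1 + a by ring, pow_add, Module.End.mul_apply]
    exact hu
  have hpq : (e ^ b) (p - q) = 0 := by
    have h1 := LinearMap.congr_fun (pow_succ_mul_eq hhe hef (a + b)) u
    simp only [Module.End.mul_apply, LinearMap.add_apply, Module.End.natCast_apply, hu', map_zero,
      zero_add, Module.End.one_apply] at h1
    rw [← Nat.cast_smul_eq_nsmul K, ← Nat.cast_smul_eq_nsmul K] at h1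
    have h2 : (e ^ (a + b)) (h u + ((a + b : ℕ) : K) • u) = (e ^ b) p := by
      rw [hp, hh, hc, add_comm a b, pow_add, Module.End.mul_apply, map_add, map_smul]
      congr 1
      push_cast
      module
    have h3 : (e ^ (a + b + 1)) (f u) = (((a + b : ℕ) : K) + 1) • (e ^ b) p := by
      rw [h1, h2, add_smul, one_smul]
    have h4 : (e ^ b) q = (((a + b : ℕ) : K) + 1)⁻¹ • (e ^ (a + b + 1)) (f u) := by
      rw [hq, map_smul, ← Module.End.mul_apply, ← pow_add, show b + (a + 1) = a + b + 1 by ring]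
    rw [map_sub, h4, h3, inv_smul_smul₀ hne, sub_self]
  have hqr : q ∈ (e ^ (a + 1)).range := Submodule.smul_mem _ _ ⟨_, rfl⟩
  have hpr : p ∈ (e ^ a).range := hrange a _ _ ⟨_, rfl⟩
  have hqk : q ∈ (e ^ (b + 1)).ker := by
    have h1 : p ∈ (e ^ (b + 1)).ker := hker _ _ _ hu
    rw [map_sub, sub_eq_zero] at hpq
    rw [LinearMap.mem_ker, pow_succ', Module.End.mul_apply] at h1 ⊢
    rwa [← hpq]
  have hqa : q ∈ (e ^ a).range := by
    obtain ⟨w, hw⟩ := hqr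
    exact ⟨e w, by rw [← hw, pow_succ, Module.End.mul_apply]⟩
  rw [← add_sub_cancel q p]
  exact Submodule.add_mem _ (le_weightFiltration e (by push_cast at hab ⊢; omega) ⟨hqr, hqk⟩)
    (le_weightFiltration e (by push_cast at hab ⊢; omega) ⟨Submodule.sub_mem _ hpr hqa, hpq⟩)

/-- The neutral elements of two standard triples with the same nilpositive element are
conjugate. -/
theorem exists_unit_intertwining_neutral [CharZero K] {h h' e f f' : End K V}
    (hhe : h * e = e * h + 2 * e) (hef : e * f = f * e + h) (hhe' : h' * e = e * h' + 2 * e)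
    (hef' : e * f' = f' * e + h') (he : IsNilpotent e) :
    ∃ g : End K V, IsUnit g ∧ g * h = h' * g := by
  obtain ⟨N, hN⟩ := he
  have key : ∀ {h f : End K V}, h * e = e * h + 2 * e → e * f = f * e + h → ∀ (i : ℕ),
      ∀ v ∈ weightFiltration e ((N : ℤ) - (i + 1 : ℕ)),
        h v - ((N : K) - i) • v ∈ weightFiltration e ((N : ℤ) - i) := by
    intro h f hhe hef i v hv
    have h1 := sub_smul_mem_weightFiltration hhe hef _ hv
    have h2 : (((N : ℤ) - (i + 1 : ℕ) : ℤ) : K) + 1 = (N : K) - i := by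
      push_cast
      ring
    rw [h2, show (N : ℤ) - (i + 1 : ℕ) + 1 = (N : ℤ) - i by push_cast; ring] at h1
    exact h1
  -- The filtration is zero at index N and everything at -N, so reversing it gives a flag of length
  -- 2N. The scalars N - i are distinct in characteristic zero.
  refine exists_unit_intertwining (F := fun i => weightFiltration e ((N : ℤ) - i)) (s := 2 * N)
    (χ := fun i => (N : K) - i) ?_ ?_ ?_ ?_ (key hhe hef) (key hhe' hef')
  · simpa using weightFiltration_eq_bot hN
  · exact fun i j hij => weightFiltration_antitone e (by omega)
  · have : (N : ℤ) - (2 * N : ℕ) = -N := by push_cast; ring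
    simp only [this]
    exact weightFiltration_eq_top hN
  · intro i _ j _ hij
    simpa using hij

end WeightFiltration

/-! ### Conjugacy of matrices -/

section Conjugacy

variable {K ι : Type*} [Field K] [Fintype ι] [DecidableEq ι]

theorem isConj_of_toLin' {x y : Matrix ι ι K}
    (h : ∃ g : End K (ι → K), IsUnit g ∧ g * x.toLin' = y.toLin' * g) : IsConj x y := by
  obtain ⟨g, ⟨u, rfl⟩, hg⟩ := h
  have h1 : IsConj (Matrix.toLinAlgEquiv' x) (Matrix.toLinAlgEquiv' y) := ⟨u, hg⟩
  simpa using
    (Matrix.toLinAlgEquiv' (R := K) (n := ι)).symm.toAlgHom.toRingHom.toMonoidHom.map_isConj h1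

theorem isConj_iff_matrix {x y : Matrix ι ι K} :
    IsConj x y ↔ ∃ g : Matrix.GeneralLinearGroup ι K,
      y = g * x * (g⁻¹ : Matrix.GeneralLinearGroup ι K) := by
  refine exists_congr fun g => ?_
  rw [Units.eq_mul_inv_iff_mul_eq]
  exact eq_comm

theorem rank_eq_of_isConj {x y : Matrix ι ι K} (h : IsConj x y) : x.rank = y.rank := by
  obtain ⟨g, rfl⟩ := isConj_iff_matrix.1 h
  rw [Matrix.rank_mul_eq_left_of_isUnit_det _ _ ((Matrix.isUnit_iff_isUnit_det _).1 (Units.isUnit _)),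
    Matrix.rank_mul_eq_right_of_isUnit_det _ _ ((Matrix.isUnit_iff_isUnit_det _).1 (Units.isUnit _))]

theorem trace_eq_of_isConj {x y : Matrix ι ι K} (h : IsConj x y) : x.trace = y.trace := by
  obtain ⟨g, rfl⟩ := isConj_iff_matrix.1 h
  exact (Matrix.trace_units_conj g x).symm

theorem isConj_smul {x y : Matrix ι ι K} (h : IsConj x y) (c : K) : IsConj (c • x) (c • y) := by
  obtain ⟨g, hg⟩ := h
  exact ⟨g, hg.smul_right c⟩

theorem isConj_pow {x y : Matrix ι ι K} (h : IsConj x y) (k : ℕ) : IsConj (x ^ k) (y ^ k) :=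
  h.imp fun _ hg => hg.pow_right k

theorem isConj_neutral [CharZero K] {h h' e f f' : Matrix ι ι K}
    (hhe : h * e = e * h + 2 * e) (hef : e * f = f * e + h) (hhe' : h' * e = e * h' + 2 * e)
    (hef' : e * f' = f' * e + h') (he : IsNilpotent e) : IsConj h h' := by
  let φ := Matrix.toLinAlgEquiv' (R := K) (n := ι)
  refine isConj_of_toLin' (exists_unit_intertwining_neutral (h := φ h) (e := φ e) (f := φ f)
    (h' := φ h') (f' := φ f') ?_ ?_ ?_ ?_ (he.map φ))
  · simpa [map_ofNat φ 2] using congrArg φ hhe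
  · simpa using congrArg φ hef
  · simpa [map_ofNat φ 2] using congrArg φ hhe'
  · simpa using congrArg φ hef'

theorem rank_eq_finrank_toLin'_pow (x : Matrix ι ι K) (k : ℕ) :
    (x ^ k).rank = finrank K (x.toLin' ^ k).range := by
  rw [← Matrix.toLin'_pow]
  rfl

/-- Nilpotent matrices whose powers have the same ranks are conjugate. -/
theorem isConj_of_rank_pow_eq {x y : Matrix ι ι K} (hx : IsNilpotent x)
    (h : ∀ k, (x ^ k).rank = (y ^ k).rank) : IsConj x y := by
  obtain ⟨N, hN⟩ := hx
  obtain ⟨g, hg⟩ := exists_equiv_of_finrank_range_pow_eq N x.toLin' y.toLin'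
    (by rw [← Matrix.toLin'_pow, hN, map_zero])
    (fun k => by rw [← rank_eq_finrank_toLin'_pow, ← rank_eq_finrank_toLin'_pow, h])
  exact isConj_of_toLin' ⟨g.toLinearMap, (Module.End.isUnit_iff _).2 g.bijective,
    LinearMap.ext hg⟩

end Conjugacy

/-! ### Matrices which are strictly triangular with respect to a labelling -/

section Strict

set_option linter.unusedSectionVars false

variable {K ι : Type*} [Field K] [Fintype ι] [DecidableEq ι]

/-- The entry `(i, j)` of `x` vanishes unless the label of `i` is less than that of `j`. -/
def IsStrict (l : ι → ℕ) (x : Matrix ι ι K) : Prop :=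
  ∀ i j, l j ≤ l i → x i j = 0

/-- The number of indices with label at least `k`. -/
def labelCount (l : ι → ℕ) (k : ℕ) : ℕ :=
  (Finset.univ.filter fun i => k ≤ l i).card

/-- The vectors supported on the indices with label less than `k`. -/
def labelFlag (K : Type*) [Field K] (l : ι → ℕ) (k : ℕ) : Submodule K (ι → K) where
  carrier := {v | ∀ i, k ≤ l i → v i = 0}
  zero_mem' := fun _ _ => rfl
  add_mem' := fun {v w} hv hw i hi => by rw [Pi.add_apply, hv i hi, hw i hi, add_zero]
  smul_mem' := fun c v hv i hi => by rw [Pi.smul_apply, hv i hi, smul_zero]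

theorem labelFlag_zero (l : ι → ℕ) : labelFlag K l 0 = ⊥ :=
  (Submodule.eq_bot_iff _).2 fun _ hv => funext fun i => hv i (l i).zero_le

theorem labelFlag_mono (l : ι → ℕ) : Monotone (labelFlag K l) :=
  fun _ _ hab _ hv i hi => hv i (hab.trans hi)

theorem labelFlag_eq_top {l : ι → ℕ} {s : ℕ} (hs : ∀ i, l i < s) : labelFlag K l s = ⊤ :=
  top_le_iff.1 fun _ _ i hi => absurd (hs i) (not_lt.2 hi)

theorem finrank_labelFlag (l : ι → ℕ) (k : ℕ) :
    finrank K (labelFlag K l k) = (Finset.univ.filter fun i => l i < k).card := by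
  classical
  have h : labelFlag K l k =
      (Matrix.diagonal fun i => if l i < k then (1 : K) else 0).toLin'.range := by
    ext v
    constructor
    · intro hv
      refine ⟨v, ?_⟩
      ext i
      rw [Matrix.toLin'_apply, Matrix.mulVec_diagonal]
      split_ifs with hi
      · rw [one_mul]
      · rw [zero_mul, hv i (not_lt.1 hi)]
    · rintro ⟨w, rfl⟩ i hi
      rw [Matrix.toLin'_apply, Matrix.mulVec_diagonal, if_neg (not_lt.2 hi), zero_mul]
  have h2 := Matrix.rank_diagonal fun i => if l i < k then (1 : K) else 0
  rw [h]
  refine h2.trans ?_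
  rw [Fintype.card_subtype]
  simp

theorem labelCount_add_card_lt (l : ι → ℕ) (k : ℕ) :
    labelCount l k + (Finset.univ.filter fun i => l i < k).card = Fintype.card ι := by
  have := Finset.card_filter_add_card_filter_not (s := (Finset.univ : Finset ι)) fun i => k ≤ l i
  simpa [labelCount] using this

theorem card_lt_eq_sum (l : ι → ℕ) (k : ℕ) :
    (Finset.univ.filter fun i => l i < k).card =
      ∑ j ∈ Finset.range k, (Finset.univ.filter fun i => l i = j).card := by
  rw [Finset.card_eq_sum_card_fiberwise (f := l) (t := Finset.range k) (by intro i; simp)]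
  refine Finset.sum_congr rfl fun j hj => ?_
  congr 1
  ext i
  have := Finset.mem_range.1 hj
  simp only [Finset.mem_filter, Finset.mem_univ, true_and]
  omega

/-- A nonzero entry of the `k`-th power requires a chain of `k` strict increases of the label. -/
theorem IsStrict.pow_apply_eq_zero {l : ι → ℕ} {x : Matrix ι ι K} (hx : IsStrict l x) (k : ℕ)
    {i j : ι} (h : l j < l i + k) : (x ^ k) i j = 0 := by
  induction k generalizing j with
  | zero => exact Matrix.one_apply_ne fun hij => by rw [hij] at h; omega
  | succ k ih =>
    rw [pow_succ, Matrix.mul_apply]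
    refine Finset.sum_eq_zero fun m _ => ?_
    rcases le_or_gt (l j) (l m) with hm | hm
    · rw [hx m j hm, mul_zero]
    · rw [ih (by omega), zero_mul]

/-- Only the columns with label at least `k` can survive in the `k`-th power. -/
theorem IsStrict.rank_pow_le {l : ι → ℕ} {x : Matrix ι ι K} (hx : IsStrict l x) (k : ℕ) :
    (x ^ k).rank ≤ labelCount l k := by
  classical
  have h : x ^ k = x ^ k * Matrix.diagonal fun i => if k ≤ l i then (1 : K) else 0 := by
    ext i j
    rw [Matrix.mul_diagonal]
    split_ifs with hj
    · rw [mul_one]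
    · rw [mul_zero, hx.pow_apply_eq_zero k (by omega)]
  rw [h]
  refine (Matrix.rank_mul_le_right _ _).trans ?_
  rw [Matrix.rank_diagonal, Fintype.card_subtype]
  simp [labelCount]

theorem isNilpotent_of_rank_pow_le {l : ι → ℕ} {x : Matrix ι ι K}
    (h : ∀ k, (x ^ k).rank ≤ labelCount l k) : IsNilpotent x := by
  obtain ⟨s, hs⟩ : ∃ s, ∀ i, l i < s :=
    ⟨Finset.univ.sup l + 1, fun i => Nat.lt_succ_of_le (Finset.le_sup (Finset.mem_univ i))⟩
  refine ⟨s, ?_⟩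
  have h1 := h s
  have h2 : labelCount l s = 0 := by simp [labelCount, hs]
  have h3 : (x ^ s).rank = 0 := by omega
  rw [Matrix.rank, Submodule.finrank_eq_zero, LinearMap.range_eq_bot] at h3
  exact Matrix.toLin'.injective (h3.trans (map_zero _).symm)

/-- If the ranks of the powers of `x` are at most those of a generic strictly triangular matrix,
then `x` is conjugate to a strictly triangular matrix. -/
theorem exists_isConj_isStrict {l : ι → ℕ}
    (hl : Antitone fun k => (Finset.univ.filter fun i => l i = k).card) {x : Matrix ι ι K}
    (hx : ∀ k, (x ^ k).rank ≤ labelCount l k) : ∃ y, IsConj x y ∧ IsStrict l y := by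
  obtain ⟨s, hs⟩ : ∃ s, ∀ i, l i < s :=
    ⟨Finset.univ.sup l + 1, fun i => Nat.lt_succ_of_le (Finset.le_sup (Finset.mem_univ i))⟩
  obtain ⟨U, hU0, hUm, hUd, hUx⟩ := exists_strict_flag s x.toLin' hl
    (by
      rw [← card_lt_eq_sum, ← finrank_labelFlag (K := K), labelFlag_eq_top hs, finrank_top])
    (fun k _ => by
      rw [← rank_eq_finrank_toLin'_pow, ← card_lt_eq_sum, finrank_fintype_fun_eq_card,
        ← labelCount_add_card_lt l k]
      exact Nat.add_le_add_right (hx k) _)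
  have hd : ∀ i ≤ s, finrank K (labelFlag K l i) = finrank K (U i) := fun i hi => by
    rw [hUd i hi, finrank_labelFlag, card_lt_eq_sum]
  -- Conjugating by a map that carries the coordinate flag of the labels to `U` turns strictness for
  -- `U` into vanishing entries.
  obtain ⟨g, hg, hg0⟩ := exists_linearMap_map_flag (labelFlag_zero l) (labelFlag_mono l) hUm s hd
  have hinj : Function.Injective g := (injective_iff_map_eq_zero g).2 fun v hv =>
    hg0 v (by rw [labelFlag_eq_top hs]; trivial) hv
  let G := g.linearEquivOfInjective hinj rfl
  have hG : ∀ v, G v = g v := fun v => rfl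
  have hGs : ∀ i ≤ s, ∀ v, g v ∈ U i → v ∈ labelFlag K l i := by
    intro i hi v hv
    have h1 : (labelFlag K l i).map g = U i :=
      Submodule.eq_of_le_of_finrank_eq (Submodule.map_le_iff_le_comap.2 (hg i hi))
        ((G.finrank_map_eq _).trans (hd i hi))
    rw [← h1] at hv
    obtain ⟨w, hw, hwv⟩ := hv
    rwa [← hinj hwv]
  let y : Matrix ι ι K := LinearMap.toMatrix' (G.symm.toLinearMap ∘ₗ x.toLin' ∘ₗ g)
  have hy : ∀ v, y.toLin' v = G.symm (x.toLin' (g v)) := fun v => by simp [y]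
  refine ⟨y, (isConj_of_toLin' ⟨g, ?_, ?_⟩).symm, fun i j hij => ?_⟩
  · exact (Module.End.isUnit_iff _).2 G.bijective
  · refine LinearMap.ext fun v => ?_
    rw [Module.End.mul_apply, Module.End.mul_apply, hy, ← hG, G.apply_symm_apply]
  · have h1 : Pi.single j 1 ∈ labelFlag K l (l j + 1) := fun m hm =>
      Pi.single_eq_of_ne (fun h => by rw [h] at hm; omega) _
    have h2 : y.toLin' (Pi.single j 1) ∈ labelFlag K l (l j) := by
      refine hGs _ (hs j).le _ ?_
      rw [hy, ← hG, G.apply_symm_apply]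
      exact hUx _ (hs j) (hg _ (hs j) _ h1)
    have h3 := h2 i hij
    rwa [Matrix.toLin'_apply, Matrix.mulVec_single_one] at h3

/-- A triangular matrix with scalar diagonal blocks belonging to pairwise distinct scalars is
diagonalizable. -/
theorem IsStrict.isConj_add_diagonal {l : ι → ℕ} {x : Matrix ι ι K} (hx : IsStrict l x) {s : ℕ}
    (hs : ∀ i, l i < s) {a : ℕ → K} (ha : Set.InjOn a (Finset.range s)) :
    IsConj (Matrix.diagonal fun i => a (l i)) (x + Matrix.diagonal fun i => a (l i)) := by
  have hdiag : ∀ i, ∀ v ∈ labelFlag K l (i + 1), ∀ j, i ≤ l j → a (l j) * v j = a i * v j := by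
    intro i v hv j hj
    rcases hj.lt_or_eq with h | h
    · rw [hv j h, mul_zero, mul_zero]
    · rw [h]
  -- Both matrices act on the quotients of the label flag by the same distinct scalars `a i`.
  refine isConj_of_toLin' (exists_unit_intertwining (labelFlag_zero l) (labelFlag_mono l)
    (labelFlag_eq_top hs) ha ?_ ?_)
  · intro i v hv j hj
    rw [Matrix.toLin'_apply, Pi.sub_apply, Matrix.mulVec_diagonal, hdiag i v hv j hj, Pi.smul_apply,
      smul_eq_mul, sub_self]
  · intro i v hv j hj
    have h1 : x.mulVec v j = 0 := by
      refine Finset.sum_eq_zero fun m _ => ?_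
      change x j m * v m = 0
      rcases le_or_gt (l m) (l j) with hm | hm
      · rw [hx j m hm, zero_mul]
      · rw [hv m (by omega), mul_zero]
    rw [Matrix.toLin'_apply, Pi.sub_apply, Matrix.add_mulVec, Pi.add_apply, h1,
      Matrix.mulVec_diagonal, hdiag i v hv j hj, Pi.smul_apply, smul_eq_mul, zero_add, sub_self]

end Strict

/-! ### Semicontinuity of the rank -/

section Rank

variable {K ι : Type*} [Field K] [Fintype ι] [DecidableEq ι]

/-- The rank of `A` is at least `r` if and only if some `r × r` compression of `A` is invertible. -/
theorem le_rank_iff {A : Matrix ι ι K} {r : ℕ} :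
    r ≤ A.rank ↔ ∃ (B : Matrix (Fin r) ι K) (C : Matrix ι (Fin r) K), (B * A * C).det ≠ 0 := by
  constructor
  · intro hr
    have h : r ≤ finrank K A.mulVecLin.range := hr
    obtain ⟨b⟩ : Nonempty (Basis (Fin (finrank K A.mulVecLin.range)) K A.mulVecLin.range) :=
      ⟨Module.finBasis K A.mulVecLin.range⟩
    have hb : ∀ i : Fin r, ∃ v : ι → K, A.mulVecLin v = b (Fin.castLE h i) :=
      fun i => (b (Fin.castLE h i)).2
    choose c hc using hb
    let C : Matrix ι (Fin r) K := Matrix.of fun j i => c i j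
    have hcol : (A * C).col = fun i => (b (Fin.castLE h i) : ι → K) := by
      funext i
      rw [← hc]
      rfl
    have hli : LinearIndependent K (A * C).col := by
      rw [hcol]
      have h0 : LinearIndependent K fun i => b (Fin.castLE h i) :=
        b.linearIndependent.comp (Fin.castLE h) (Fin.castLE_injective h)
      exact h0.map' (Submodule.subtype _) (Submodule.ker_subtype _)
    obtain ⟨g, hg⟩ := (A * C).mulVecLin.exists_leftInverse_of_injective
      (LinearMap.ker_eq_bot.2 (Matrix.mulVec_injective_iff.2 hli))
    refine ⟨g.toMatrix', C, ?_⟩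
    have h1 : g.toMatrix' * A * C = 1 := by
      rw [← Matrix.toLin'_apply'] at hg
      rw [Matrix.mul_assoc, ← LinearMap.toMatrix'_id, ← hg, LinearMap.toMatrix'_comp,
        LinearMap.toMatrix'_toLin']
    rw [h1, Matrix.det_one]
    exact one_ne_zero
  · rintro ⟨B, C, h⟩
    have h1 := Matrix.rank_of_isUnit (B * A * C)
      ((Matrix.isUnit_iff_isUnit_det _).2 (isUnit_iff_ne_zero.2 h))
    rw [Fintype.card_fin] at h1
    rw [← h1]
    exact (Matrix.rank_mul_le_left _ _).trans (Matrix.rank_mul_le_right _ _)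

/-- Invertibility of a fixed compression is an open condition. -/
theorem isOpen_setOf_le_rank [TopologicalSpace K] [IsTopologicalRing K] [T1Space K] (r : ℕ) :
    IsOpen {A : Matrix ι ι K | r ≤ A.rank} := by
  simp only [le_rank_iff, Set.ofPred_exists]
  refine isOpen_iUnion fun B => isOpen_iUnion fun C => ?_
  have : Continuous fun A : Matrix ι ι K => (B * A * C).det := by fun_prop
  exact isOpen_ne.preimage this

/-- The rank normal form has entries 0 and 1, so it survives extension of scalars. -/
theorem rank_map_algebraMap {L : Type*} [Field L] [Algebra K L] (A : Matrix ι ι K) :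
    (A.map (algebraMap K L)).rank = A.rank := by
  obtain ⟨V, U, e, hV, hU, h⟩ := A.exists_rank_normal_form
  have hL := congrArg (algebraMap K L).mapMatrix h
  rw [map_mul, map_mul] at hL
  have hV' := (Matrix.isUnit_iff_isUnit_det _).1 (hV.map (algebraMap K L).mapMatrix)
  have hU' := (Matrix.isUnit_iff_isUnit_det _).1 (hU.map (algebraMap K L).mapMatrix)
  have h1 := congrArg Matrix.rank hL
  rw [Matrix.rank_mul_eq_left_of_isUnit_det _ _ hU', Matrix.rank_mul_eq_right_of_isUnit_det _ _ hV']
    at h1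
  refine h1.trans ?_
  have h2 : (algebraMap K L).mapMatrix ((Matrix.fromBlocks 1 0 0 0).submatrix e e) =
      (Matrix.diagonal (Sum.elim 1 0)).submatrix e e := by
    ext i j
    simp only [RingHom.mapMatrix_apply, Matrix.map_apply, Matrix.submatrix_apply,
      Matrix.diagonal_apply]
    rcases e i with a | a <;> rcases e j with b | b <;> simp [Matrix.one_apply, apply_ite]
  classical
  rw [h2, Matrix.rank_submatrix, Matrix.rank_diagonal, Fintype.card_subtype]
  rw [← Fintype.card_subtype, Fintype.card_congr (Equiv.subtypeSum (α := Fin A.rank))]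
  simp

open Filter Topology in
/-- On the line from `x` to `y`, the rank of the `k`-th power is near `x` generically at least that
at `y`. -/
theorem eventually_rank_pow_le {ι : Type*} [Fintype ι] [DecidableEq ι] (x y : Matrix ι ι ℝ)
    (k : ℕ) : ∀ᶠ t in 𝓝[≠] (0 : ℝ), (y ^ k).rank ≤ ((x + t • (y - x)) ^ k).rank := by
  obtain ⟨B, C, h⟩ := le_rank_iff.1 (le_refl (y ^ k).rank)
  -- The determinant of a compression along the line is a polynomial in the parameter. It is nonzero
  -- at 1, so it has finitely many roots and none in a punctured neighbourhood of 0.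
  let P : Polynomial ℝ := (B.map Polynomial.C * (x.map Polynomial.C +
    (Polynomial.X : Polynomial ℝ) • (y - x).map Polynomial.C) ^ k * C.map Polynomial.C).det
  have hP : ∀ t, P.eval t = (B * (x + t • (y - x)) ^ k * C).det := by
    intro t
    have hB : (B.map Polynomial.C).map (Polynomial.evalRingHom t) = B := by ext; simp
    have hC : (C.map Polynomial.C).map (Polynomial.evalRingHom t) = C := by ext; simp
    have hx : (Polynomial.evalRingHom t).mapMatrix (x.map Polynomial.C +
        (Polynomial.X : Polynomial ℝ) • (y - x).map Polynomial.C) = x + t • (y - x) := by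
      ext i j; simp
    rw [← Polynomial.coe_evalRingHom, RingHom.map_det, RingHom.mapMatrix_apply, Matrix.map_mul,
      Matrix.map_mul, hB, hC, ← RingHom.mapMatrix_apply, map_pow, hx]
  have hP0 : P ≠ 0 := by
    intro h0
    have h1 := hP 1
    rw [h0, Polynomial.eval_zero, one_smul, add_sub_cancel] at h1
    exact h h1.symm
  have hfin := (Polynomial.finite_setOfPred_isRoot hP0).compl_mem_cofinite
  filter_upwards [nhdsNE_le_cofinite 0 hfin] with t ht
  refine le_rank_iff.2 ⟨B, C, ?_⟩
  rw [← hP]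
  exact ht

end Rank

/-! ### Zariski closures -/

section Zariski

variable {n : ℕ} {K : Type*} [Field K]

/-- A larger rank at `x` would be detected by the determinant of an (r+1) × (r+1) compression of the
power. That determinant is a polynomial in the entries vanishing on `S`. -/
theorem rank_pow_le_of_mem_zariskiClosure {S : Set (sln n K)} {k r : ℕ}
    (hS : ∀ y ∈ S, ((y : Matrix (Fin n) (Fin n) K) ^ k).rank ≤ r) {x : sln n K}
    (hx : x ∈ zariskiClosure S) : ((x : Matrix (Fin n) (Fin n) K) ^ k).rank ≤ r := by
  by_contra! hr
  obtain ⟨B, C, h⟩ := le_rank_iff.1 (Nat.succ_le_of_lt hr)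
  let P : MvPolynomial (Fin n × Fin n) K := Matrix.det
    ((B.map MvPolynomial.C : Matrix _ _ (MvPolynomial (Fin n × Fin n) K)) *
      (Matrix.mvPolynomialX (Fin n) (Fin n) K) ^ k *
      (C.map MvPolynomial.C : Matrix _ _ (MvPolynomial (Fin n × Fin n) K)))
  have hP : ∀ A : Matrix (Fin n) (Fin n) K,
      MvPolynomial.eval (fun ij => A ij.1 ij.2) P = (B * A ^ k * C).det := by
    intro A
    have hm : ∀ {a b : Type} (D : Matrix a b K), (D.map MvPolynomial.C).map
        (MvPolynomial.eval fun ij : Fin n × Fin n => A ij.1 ij.2) = D := fun D => by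
      ext; simp
    rw [RingHom.map_det, RingHom.mapMatrix_apply, Matrix.map_mul, Matrix.map_mul, hm, hm,
      ← RingHom.mapMatrix_apply, map_pow, Matrix.mvPolynomialX_mapMatrix_eval]
  refine h ?_
  rw [← hP]
  refine hx P fun y hy => ?_
  rw [hP]
  by_contra hne
  have := le_rank_iff.2 ⟨B, C, hne⟩
  have := hS y hy
  omega

theorem closure_subset_zariskiClosure [TopologicalSpace K] [IsTopologicalRing K] [T1Space K]
    (S : Set (sln n K)) : closure S ⊆ zariskiClosure S := by
  intro x hx p hp
  have hc : Continuous fun y : sln n K =>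
      MvPolynomial.eval (fun ij : Fin n × Fin n => (y : Matrix (Fin n) (Fin n) K) ij.1 ij.2) p :=
    (MvPolynomial.continuous_eval p).comp
      (continuous_pi fun ij => continuous_subtype_val.matrix_elem ij.1 ij.2)
  exact closure_minimal (fun y hy => hp y hy) (isClosed_singleton.preimage hc) hx

end Zariski

/-! ### Jordan matrices -/

section Jordan

variable {n : ℕ} (Λ : n.Partition)

/-- The number of the Jordan block containing a basis vector. -/
def blockIndex (i : Fin n) : Fin (partsList Λ).length :=
  ((blockEquiv Λ).symm i).1

/-- The position of a basis vector in its Jordan block. -/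
def label (i : Fin n) : ℕ :=
  ((blockEquiv Λ).symm i).2

/-- The size of the Jordan block containing a basis vector. -/
def partSize (i : Fin n) : ℕ :=
  (partsList Λ).get (blockIndex Λ i)

theorem label_lt_partSize (i : Fin n) : label Λ i < partSize Λ i :=
  ((blockEquiv Λ).symm i).2.2

theorem eq_of_blockIndex_of_label {i j : Fin n} (h1 : blockIndex Λ i = blockIndex Λ j)
    (h2 : label Λ i = label Λ j) : i = j := by
  refine (blockEquiv Λ).symm.injective ?_
  unfold blockIndex at h1
  unfold label at h2
  generalize (blockEquiv Λ).symm i = p at *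
  generalize (blockEquiv Λ).symm j = q at *
  obtain ⟨b, p⟩ := p
  obtain ⟨b', q⟩ := q
  obtain rfl : b = b' := h1
  exact congrArg _ (Fin.ext h2)

theorem exists_blockIndex_label {i : Fin n} {k : ℕ} (hk : k < partSize Λ i) :
    ∃ j, blockIndex Λ j = blockIndex Λ i ∧ label Λ j = k := by
  refine ⟨blockEquiv Λ ⟨blockIndex Λ i, ⟨k, hk⟩⟩, ?_, ?_⟩
  · rw [blockIndex, Equiv.symm_apply_apply]
  · rw [label, Equiv.symm_apply_apply]

theorem partSize_eq_of_blockIndex_eq {i j : Fin n} (h : blockIndex Λ i = blockIndex Λ j) :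
    partSize Λ i = partSize Λ j :=
  congrArg (partsList Λ).get h

/-- Sums over basis vectors are sums over the parts and the positions. -/
theorem sum_partSize_label {A : Type*} [AddCommMonoid A] (f : ℕ → ℕ → A) :
    ∑ i, f (partSize Λ i) (label Λ i) =
      (Λ.parts.map fun d => ∑ j ∈ Finset.range d, f d j).sum := by
  have h1 : ∑ i, f (partSize Λ i) (label Λ i) =
      ∑ p : Σ k : Fin (partsList Λ).length, Fin ((partsList Λ).get k),
        f ((partsList Λ).get p.1) p.2 :=
    Equiv.sum_comp (blockEquiv Λ).symm fun p => f ((partsList Λ).get p.1) p.2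
  have h2 : Λ.parts = (partsList Λ : Multiset ℕ) := (Multiset.sort_eq _ _).symm
  rw [h1, Fintype.sum_sigma, h2, Multiset.map_coe, Multiset.sum_coe, ← List.sum_ofFn]
  congr 1
  refine List.ext_get (by simp) fun i hi hi' => ?_
  simp [Finset.sum_range]

/-- Stepping back by one position within a block injects the vectors of label `k + 1` into those of
label `k`. This monotonicity is what the strict flag needs. -/
theorem antitone_card_label :
    Antitone fun k => (Finset.univ.filter fun i => label Λ i = k).card := by
  refine antitone_nat_of_succ_le fun k => ?_
  have h : ∀ i, ∃ j, label Λ i = k + 1 → blockIndex Λ j = blockIndex Λ i ∧ label Λ j = k := by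
    intro i
    by_cases hi : label Λ i = k + 1
    · obtain ⟨j, hj⟩ := exists_blockIndex_label Λ (i := i) (k := k)
        (by have := label_lt_partSize Λ i; omega)
      exact ⟨j, fun _ => hj⟩
    · exact ⟨i, fun h => absurd h hi⟩
  choose p hp using h
  refine Finset.card_le_card_of_injOn p (fun i hi => ?_) fun i hi j hj hij => ?_
  · simp only [Finset.coe_filter, Finset.mem_univ, true_and, Set.mem_ofPred_eq] at hi ⊢
    exact (hp i hi).2
  · simp only [Finset.coe_filter, Finset.mem_univ, true_and, Set.mem_ofPred_eq] at hi hj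
    refine eq_of_blockIndex_of_label Λ ?_ (by rw [hi, hj])
    rw [← (hp i hi).1, ← (hp j hj).1, hij]

variable (K : Type*) [Field K]

/-- The block diagonal matrix over `K` with nilpotent Jordan blocks of sizes the parts of `Λ`. -/
def jordanMat : Matrix (Fin n) (Fin n) K :=
  Matrix.reindex (blockEquiv Λ) (blockEquiv Λ)
    (Matrix.blockDiagonal' fun k => jordanBlock K ((partsList Λ).get k))

/-- The neutral element of the standard triple through the Jordan matrix. -/
def neutralMat : Matrix (Fin n) (Fin n) K :=
  Matrix.diagonal fun i => (((partSize Λ i : ℤ) - 1 - 2 * label Λ i : ℤ) : K)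

theorem coe_jordanMatrix : (jordanMatrix Λ : Matrix (Fin n) (Fin n) ℂ) = jordanMat Λ ℂ :=
  rfl

theorem blockDiagonal'_apply_eq {o : Type*} [DecidableEq o] {m : o → ℕ}
    (φ : ℕ → ℕ → ℕ → K) (p q : Σ k, Fin (m k)) :
    Matrix.blockDiagonal' (fun k => Matrix.of fun i j : Fin (m k) => φ (m k) i j) p q =
      if p.1 = q.1 then φ (m p.1) p.2 q.2 else 0 := by
  obtain ⟨b, p⟩ := p
  obtain ⟨b', q⟩ := q
  by_cases h : b = b'
  · subst h
    simp
  · rw [Matrix.blockDiagonal'_apply_ne _ _ _ h, if_neg h]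

theorem jordanMat_apply (i j : Fin n) : jordanMat Λ K i j =
    if blockIndex Λ i = blockIndex Λ j ∧ label Λ i + 1 = label Λ j then 1 else 0 := by
  have h := blockDiagonal'_apply_eq K (m := fun k => (partsList Λ).get k)
    (fun _ i j => if i + 1 = j then (1 : K) else 0) ((blockEquiv Λ).symm i) ((blockEquiv Λ).symm j)
  rw [ite_and]
  exact h

theorem jordanMat_map {L : Type*} [Field L] [Algebra K L] :
    (jordanMat Λ K).map (algebraMap K L) = jordanMat Λ L := by
  ext i j
  rw [Matrix.map_apply, jordanMat_apply, jordanMat_apply]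
  split_ifs <;> simp

theorem isStrict_jordanMat : IsStrict (label Λ) (jordanMat Λ K) := fun i j h => by
  rw [jordanMat_apply, if_neg]
  omega

theorem jordanMat_mulVec {i j : Fin n} (h1 : blockIndex Λ i = blockIndex Λ j)
    (h2 : label Λ i + 1 = label Λ j) (v : Fin n → K) : (jordanMat Λ K).mulVec v i = v j := by
  rw [Matrix.mulVec, dotProduct, Finset.sum_eq_single j]
  · rw [jordanMat_apply, if_pos ⟨h1, h2⟩, one_mul]
  · intro m _ hm
    rw [jordanMat_apply, if_neg, zero_mul]
    rintro ⟨h3, h4⟩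
    exact hm (eq_of_blockIndex_of_label Λ (h3.symm.trans h1) (h4.symm.trans h2))
  · simp

theorem apply_eq_zero_of_jordanMat_pow_mulVec (k : ℕ) {v : Fin n → K}
    (hv : ((jordanMat Λ K) ^ k).mulVec v = 0) {j : Fin n} (hj : k ≤ label Λ j) : v j = 0 := by
  induction k generalizing v j with
  | zero => simpa using congrFun hv j
  | succ k ih =>
    rw [pow_succ, ← Matrix.mulVec_mulVec] at hv
    obtain ⟨i, hi, hi'⟩ := exists_blockIndex_label Λ (i := j) (k := label Λ j - 1)
      (by have := label_lt_partSize Λ j; omega)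
    rw [← jordanMat_mulVec Λ K hi (by omega) v]
    exact ih hv (by omega)

/-- The upper bound is strictness. For the lower one, the Jordan matrix shifts coordinates along
blocks, so the kernel of its `k`-th power is supported on labels below `k`. -/
theorem rank_jordanMat_pow (k : ℕ) : ((jordanMat Λ K) ^ k).rank = labelCount (label Λ) k := by
  refine le_antisymm ((isStrict_jordanMat Λ K).rank_pow_le k) ?_
  have h1 := ((jordanMat Λ K) ^ k).mulVecLin.finrank_range_add_finrank_ker
  have h2 : ((jordanMat Λ K) ^ k).mulVecLin.ker ≤ labelFlag K (label Λ) k := fun v hv j hj =>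
    apply_eq_zero_of_jordanMat_pow_mulVec Λ K k hv hj
  have h3 := Submodule.finrank_mono h2
  have h4 := labelCount_add_card_lt (label Λ) k
  rw [finrank_labelFlag] at h3
  rw [finrank_fintype_fun_eq_card] at h1
  change _ ≤ finrank K ((jordanMat Λ K) ^ k).mulVecLin.range
  omega

theorem isNilpotent_jordanMat : IsNilpotent (jordanMat Λ K) :=
  isNilpotent_of_rank_pow_le fun k => (rank_jordanMat_pow Λ K k).le

/-- The nilnegative element of the standard triple through the Jordan matrix. -/
def lowerMat : Matrix (Fin n) (Fin n) K := Matrix.of fun i j =>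
  if blockIndex Λ i = blockIndex Λ j ∧ label Λ i = label Λ j + 1 then
    ((label Λ i * (partSize Λ i - label Λ i) : ℤ) : K) else 0

theorem neutralMat_mul_jordanMat : neutralMat Λ K * jordanMat Λ K =
    jordanMat Λ K * neutralMat Λ K + 2 * jordanMat Λ K := by
  ext i j
  have h2 : (2 * jordanMat Λ K : Matrix (Fin n) (Fin n) K) i j = 2 * jordanMat Λ K i j := by
    rw [two_mul, Matrix.add_apply, two_mul]
  rw [neutralMat, Matrix.add_apply, Matrix.diagonal_mul, Matrix.mul_diagonal, h2, jordanMat_apply]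
  split_ifs with h
  · rw [partSize_eq_of_blockIndex_eq Λ h.1, ← h.2]
    push_cast
    ring
  · ring

theorem jordanMat_mul_lowerMat : jordanMat Λ K * lowerMat Λ K =
    lowerMat Λ K * jordanMat Λ K + neutralMat Λ K := by
  -- At label l in a block of size d the two products have diagonal entries (l+1)(d-l-1) and l(d-l),
  -- which differ by d-1-2l. At the ends of a block the missing neighbour is matched by a vanishing
  -- factor.
  have hJF : jordanMat Λ K * lowerMat Λ K = Matrix.diagonal fun i =>
      (((label Λ i + 1) * (partSize Λ i - (label Λ i + 1)) : ℤ) : K) := by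
    ext i j
    rw [Matrix.diagonal_apply]
    by_cases h : label Λ i + 1 < partSize Λ i
    · obtain ⟨m, hm, hm'⟩ := exists_blockIndex_label Λ h
      refine (jordanMat_mulVec Λ K hm.symm hm'.symm fun m => lowerMat Λ K m j).trans ?_
      rw [lowerMat, Matrix.of_apply, hm, hm', partSize_eq_of_blockIndex_eq Λ hm]
      by_cases hij : i = j
      · subst hij
        rw [if_pos ⟨rfl, rfl⟩, if_pos rfl]
        push_cast
        ring
      · rw [if_neg hij, if_neg]
        rintro ⟨h1, h2⟩
        exact hij (eq_of_blockIndex_of_label Λ h1 (Nat.succ_injective h2))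
    · have h0 : label Λ i + 1 = partSize Λ i := by
        have := label_lt_partSize Λ i
        omega
      have h1 : ((label Λ i : ℤ) + 1) * (partSize Λ i - (label Λ i + 1)) = 0 := by
        rw [← h0]
        push_cast
        ring
      rw [h1, Int.cast_zero, ite_self, Matrix.mul_apply]
      refine Finset.sum_eq_zero fun m _ => ?_
      rw [jordanMat_apply, if_neg, zero_mul]
      rintro ⟨h2, h3⟩
      have h4 := label_lt_partSize Λ m
      rw [partSize_eq_of_blockIndex_eq Λ h2] at h0
      omega
  have hFJ : lowerMat Λ K * jordanMat Λ K = Matrix.diagonal fun i =>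
      ((label Λ i * (partSize Λ i - label Λ i) : ℤ) : K) := by
    ext i j
    rw [Matrix.mul_apply, Matrix.diagonal_apply]
    by_cases h : label Λ i = 0
    · have h1 : ((label Λ i : ℤ)) * (partSize Λ i - label Λ i) = 0 := by
        rw [h, Nat.cast_zero, zero_mul]
      rw [h1, Int.cast_zero, ite_self]
      refine Finset.sum_eq_zero fun m _ => ?_
      rw [lowerMat, Matrix.of_apply, if_neg, zero_mul]
      omega
    · obtain ⟨m, hm, hm'⟩ := exists_blockIndex_label Λ (i := i) (k := label Λ i - 1)
        (by have := label_lt_partSize Λ i; omega)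
      have hm'' : label Λ i = label Λ m + 1 := by omega
      rw [Finset.sum_eq_single m]
      · rw [lowerMat, Matrix.of_apply, if_pos ⟨hm.symm, hm''⟩, jordanMat_apply, hm, ← hm'']
        by_cases hij : i = j
        · subst hij
          rw [if_pos ⟨rfl, rfl⟩, if_pos rfl, mul_one]
        · rw [if_neg hij, if_neg, mul_zero]
          rintro ⟨h1, h2⟩
          exact hij (eq_of_blockIndex_of_label Λ h1 h2)
      · intro m' _ hne
        rw [lowerMat, Matrix.of_apply, if_neg, zero_mul]
        rintro ⟨h1, h2⟩
        exact hne (eq_of_blockIndex_of_label Λ (h1.symm.trans hm.symm) (by omega))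
      · simp
  rw [hJF, hFJ, neutralMat, Matrix.diagonal_add]
  congr 1
  funext i
  push_cast
  ring

end Jordan

/-! ### The eigenvalues of the neutral element -/

section Weights

/-- The weights of the irreducible representation of dimension `d`. -/
def weights (d : ℕ) : Finset ℤ :=
  (Finset.range d).image fun j : ℕ => (d : ℤ) - 1 - 2 * j

theorem mem_weights {d : ℕ} {z : ℤ} : z ∈ weights d ↔ ∃ j < d, (d : ℤ) - 1 - 2 * j = z := by
  simp [weights]

theorem card_weights (d : ℕ) : (weights d).card = d := by
  rw [weights, Finset.card_image_of_injective _ fun i j h => by simpa using h, Finset.card_range]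

theorem weights_val (d : ℕ) :
    (weights d).val = ∑ j ∈ Finset.range d, ({(d : ℤ) - 1 - 2 * (j : ℤ)} : Multiset ℤ) := by
  rw [weights, Finset.image_val_of_injOn fun i _ j _ h => by simpa using h]
  exact (Multiset.sum_map_singleton _).symm.trans (by rw [Multiset.map_map]; rfl)

/-- Weight strings have step two and are centred at zero, so the shorter one sits (d - c)/2 steps
inside the longer. -/
theorem weights_subset {c d : ℕ} (hcd : c ≤ d) (h : c = 0 ∨ (Even c ↔ Even d)) :
    weights c ⊆ weights d := by
  intro z hz
  obtain ⟨j, hj, rfl⟩ := mem_weights.1 hz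
  have h' : c % 2 = d % 2 := by
    rcases h with h | h
    · omega
    · rw [Nat.even_iff, Nat.even_iff] at h
      omega
  exact mem_weights.2 ⟨j + (d - c) / 2, by omega, by push_cast; omega⟩

/-- Even dimensions have odd weights and odd dimensions have even weights. -/
theorem disjoint_weights {c d : ℕ} (hc : Even c) (hd : d = 0 ∨ Odd d) :
    Disjoint (weights c) (weights d) := by
  rw [Finset.disjoint_left]
  intro z hz hz'
  obtain ⟨i, hi, rfl⟩ := mem_weights.1 hz
  obtain ⟨j, hj, hij⟩ := mem_weights.1 hz'
  rw [Nat.even_iff] at hc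
  rw [Nat.odd_iff] at hd
  omega

theorem exists_perm_of_map_univ_eq {α β : Type*} [Fintype α] [DecidableEq β] {f g : α → β}
    (h : Finset.univ.val.map f = Finset.univ.val.map g) :
    ∃ σ : Equiv.Perm α, ∀ i, f i = g (σ i) := by
  have hc : ∀ z, Nonempty ({i // f i = z} ≃ {i // g i = z}) := by
    intro z
    refine Fintype.card_eq.1 ?_
    have h1 := congrArg (Multiset.count z) h
    rw [Multiset.count_map, Multiset.count_map] at h1
    rw [Fintype.card_subtype, Fintype.card_subtype]
    simp only [eq_comm (a := z)] at h1
    exact h1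
  exact ⟨Equiv.ofFiberEquiv fun z => (hc z).some, fun i => (Equiv.ofFiberEquiv_map _ i).symm⟩

/-- A decreasing chain of finite sets consists of the initial segments of a sequence. -/
theorem exists_list_take_eq {α : Type*} [DecidableEq α] (L : List (Finset α))
    (hL : L.Pairwise (· ⊇ ·)) : ∃ a : List α, a.Nodup ∧
      (∀ T : Finset α, (∀ S ∈ L, S ⊆ T) → ∀ z ∈ a, z ∈ T) ∧
      ∀ S ∈ L, S.card ≤ a.length ∧ (a.take S.card : Multiset α) = S.val := by
  induction L with
  | nil => exact ⟨[], List.nodup_nil, fun _ _ z hz => absurd hz List.not_mem_nil, by simp⟩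
  | cons T L ih =>
    obtain ⟨hT, hL⟩ := List.pairwise_cons.1 hL
    obtain ⟨a, ha, haT, hS⟩ := ih hL
    have haT' := haT T hT
    -- The smaller sets are listed first. Appending the elements of `T` not yet listed leaves the
    -- earlier initial segments unchanged.
    have hnd : (a ++ (T \ a.toFinset).toList).Nodup := by
      refine List.Nodup.append ha (Finset.nodup_toList _) fun z hz hz' => ?_
      simp only [Finset.mem_toList, Finset.mem_sdiff, List.mem_toFinset] at hz'
      exact hz'.2 hz
    have hval : ((a ++ (T \ a.toFinset).toList : List α) : Multiset α) = T.val := by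
      refine (Multiset.Nodup.ext (Multiset.coe_nodup.2 hnd) T.nodup).2 fun z => ?_
      simp only [Multiset.mem_coe, List.mem_append, Finset.mem_toList, Finset.mem_sdiff,
        List.mem_toFinset, Finset.mem_val]
      by_cases hz : z ∈ a
      · simp [hz, haT' z hz]
      · simp [hz]
    have hlen : (a ++ (T \ a.toFinset).toList).length = T.card := by
      rw [← Multiset.coe_card, hval, Finset.card_val]
    refine ⟨a ++ (T \ a.toFinset).toList, hnd, fun T' hT' z hz => ?_, fun S hS' => ?_⟩
    · refine hT' T (by simp) ?_
      rw [← Finset.mem_val, ← hval]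
      exact hz
    · rcases List.mem_cons.1 hS' with rfl | hS'
      · rw [← hlen, List.take_length, hlen]
        exact ⟨le_rfl, hval⟩
      · obtain ⟨h1, h2⟩ := hS S hS'
        refine ⟨h1.trans (by simp), ?_⟩
        rw [List.take_append_of_le_length h1, h2]

/-- The pairs of terms at the same places of two sequences, extended by zeros. -/
def zipPad : List ℕ → List ℕ → List (ℕ × ℕ)
  | [], m => m.map fun b => (0, b)
  | a :: l, [] => (a :: l).map fun a => (a, 0)
  | a :: l, b :: m => (a, b) :: zipPad l m

theorem map_add_zipPad (l m : List ℕ) :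
    (zipPad l m).map (fun p => p.1 + p.2) = termwiseAdd l m := by
  induction l generalizing m with
  | nil => simp [zipPad, termwiseAdd, Function.comp_def]
  | cons a l ih =>
    cases m with
    | nil => simp [zipPad, termwiseAdd, Function.comp_def]
    | cons b m => simp [zipPad, termwiseAdd, ih]

theorem sum_map_zipPad {A : Type*} [AddCommMonoid A] {g : ℕ → A} (hg : g 0 = 0) (l m : List ℕ) :
    ((zipPad l m).map fun p => g p.1 + g p.2).sum = (l.map g).sum + (m.map g).sum := by
  induction l generalizing m with
  | nil => simp [zipPad, hg, Function.comp_def]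
  | cons a l ih =>
    cases m with
    | nil => simp [zipPad, hg, Function.comp_def]
    | cons b m => simp [zipPad, ih, add_add_add_comm]

theorem mem_of_mem_zipPad {l m : List ℕ} {p : ℕ × ℕ} (hp : p ∈ zipPad l m) :
    (p.1 = 0 ∨ p.1 ∈ l) ∧ (p.2 = 0 ∨ p.2 ∈ m) := by
  induction l generalizing m with
  | nil =>
    obtain ⟨b, hb, rfl⟩ := List.mem_map.1 hp
    exact ⟨Or.inl rfl, Or.inr hb⟩
  | cons a l ih =>
    cases m with
    | nil =>
      obtain ⟨b, hb, rfl⟩ := List.mem_map.1 hp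
      exact ⟨Or.inr hb, Or.inl rfl⟩
    | cons b m =>
      rcases List.mem_cons.1 hp with rfl | hp
      · simp
      · have := ih hp
        simp only [List.mem_cons]
        tauto

theorem pairwise_zipPad {l m : List ℕ} (hl : l.Pairwise (· ≥ ·)) (hm : m.Pairwise (· ≥ ·)) :
    (zipPad l m).Pairwise fun p q => q.1 ≤ p.1 ∧ q.2 ≤ p.2 := by
  induction l generalizing m with
  | nil => simpa [zipPad, List.pairwise_map] using hm
  | cons a l ih =>
    cases m with
    | nil =>
      rw [zipPad, List.pairwise_map]
      simpa using hl
    | cons b m =>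
      obtain ⟨h1, h2⟩ := List.pairwise_cons.1 hl
      obtain ⟨h3, h4⟩ := List.pairwise_cons.1 hm
      refine List.pairwise_cons.2 ⟨fun p hp => ?_, ih h2 h4⟩
      obtain ⟨h5, h6⟩ := mem_of_mem_zipPad hp
      exact ⟨h5.elim (fun h => h ▸ a.zero_le) (h1 _), h6.elim (fun h => h ▸ b.zero_le) (h3 _)⟩

variable {n : ℕ} (Λ : n.Partition)

theorem even_of_mem_evenParts {d : ℕ} (hd : d ∈ evenParts Λ) : Even d :=
  Multiset.of_mem_filter ((Multiset.mem_sort _).1 hd)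

theorem odd_of_mem_oddParts {d : ℕ} (hd : d ∈ oddParts Λ) : Odd d :=
  Multiset.of_mem_filter ((Multiset.mem_sort _).1 hd)

theorem coe_evenParts_add_coe_oddParts :
    (evenParts Λ : Multiset ℕ) + (oddParts Λ : Multiset ℕ) = Λ.parts := by
  rw [evenParts, oddParts, Multiset.sort_eq, Multiset.sort_eq]
  have h : Λ.parts.filter Odd = Λ.parts.filter fun a => ¬ Even a :=
    Multiset.filter_congr fun a _ => Nat.not_even_iff_odd.symm
  rw [h, Multiset.filter_add_not]

theorem mem_evenParts {d : ℕ} : d ∈ evenParts Λ ↔ d ∈ Λ.parts ∧ Even d := by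
  rw [evenParts, Multiset.mem_sort, Multiset.mem_filter]

theorem mem_oddParts {d : ℕ} : d ∈ oddParts Λ ↔ d ∈ Λ.parts ∧ Odd d := by
  rw [oddParts, Multiset.mem_sort, Multiset.mem_filter]

/-- The eigenvalues of the neutral element associated with `Λ` can be numbered in such a way that
the `k`-th one has as many occurrences as there are basis vectors of label `k` in the Jordan basis
associated with `Λ⁰ + Λ¹`. -/
theorem exists_labelled_weights : ∃ (a : ℕ → ℤ) (s : ℕ),
    (∀ i, label (evenAddOdd Λ) i < s) ∧ Set.InjOn a (Finset.range s) ∧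
    ∃ σ : Equiv.Perm (Fin n), ∀ i,
      (partSize Λ i : ℤ) - 1 - 2 * label Λ i = a (label (evenAddOdd Λ) (σ i)) := by
  -- Each even part is paired with the odd part at the same place. The unions of their strings
  -- decrease, so a single list `a` has them all as initial segments; label j then receives its j-th
  -- entry.
  let S : ℕ × ℕ → Finset ℤ := fun p => weights p.1 ∪ weights p.2
  -- The asymmetry comes from the padding zero, which is even.
  have hpar : ∀ p ∈ zipPad (evenParts Λ) (oddParts Λ), Even p.1 ∧ (p.2 = 0 ∨ Odd p.2) := by
    intro p hp
    obtain ⟨h1, h2⟩ := mem_of_mem_zipPad hp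
    exact ⟨h1.elim (fun h => h ▸ Even.zero) fun h => even_of_mem_evenParts Λ h,
      h2.imp_right fun h => odd_of_mem_oddParts Λ h⟩
  have hcard : ∀ p ∈ zipPad (evenParts Λ) (oddParts Λ), (S p).card = p.1 + p.2 := by
    intro p hp
    rw [Finset.card_union_of_disjoint (disjoint_weights (hpar p hp).1 (hpar p hp).2),
      card_weights, card_weights]
  have hchain : ((zipPad (evenParts Λ) (oddParts Λ)).map S).Pairwise (· ⊇ ·) := by
    rw [List.pairwise_map]
    refine (pairwise_zipPad (Multiset.pairwise_sort _ _) (Multiset.pairwise_sort _ _)).imp_of_mem ?_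
    intro p q hp hq h
    refine Finset.union_subset_union (weights_subset h.1 (Or.inr ?_)) (weights_subset h.2 ?_)
    · simp [(hpar p hp).1, (hpar q hq).1]
    · rcases (hpar q hq).2 with h1 | h1
      · exact Or.inl h1
      · rcases (hpar p hp).2 with h2 | h2
        · have := h.2
          left
          omega
        · right
          simp [← Nat.not_odd_iff_even, h1, h2]
  obtain ⟨a, ha, -, haS⟩ := exists_list_take_eq _ hchain
  have htake : ∀ d ≤ a.length, ∑ j ∈ Finset.range d, ({a.getD j 0} : Multiset ℤ) = a.take d := by
    intro d hd
    induction d with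
    | zero => simp
    | succ d ih =>
      rw [Finset.sum_range_succ, ih (by omega), ← List.take_append_getElem (by omega),
        List.getD_eq_getElem _ _ (by omega)]
      rfl
  have hparts : (evenAddOdd Λ).parts =
      (((zipPad (evenParts Λ) (oddParts Λ)).map fun p => p.1 + p.2 : List ℕ) : Multiset ℕ) := by
    rw [map_add_zipPad]
    rfl
  -- The default value is never reached: all labels are below the length of `a`.
  refine ⟨fun j => a.getD j 0, a.length, fun i => ?_, fun i hi j hj hij => ?_, ?_⟩
  · have h1 : partSize (evenAddOdd Λ) i ∈ (evenAddOdd Λ).parts :=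
      (Multiset.mem_sort (r := (· ≥ ·))).1 (List.get_mem _ _)
    rw [hparts, Multiset.mem_coe, List.mem_map] at h1
    obtain ⟨p, hp, hp'⟩ := h1
    have h2 := (haS (S p) (List.mem_map_of_mem hp)).1
    rw [hcard p hp, hp'] at h2
    exact (label_lt_partSize _ i).trans_le h2
  · simp only [Finset.coe_range, Set.mem_Iio] at hi hj
    simp only [List.getD_eq_getElem _ _ hi, List.getD_eq_getElem _ _ hj] at hij
    exact (ha.getElem_inj_iff).1 hij
  · have key : (Finset.univ.val.map fun i : Fin n => (partSize Λ i : ℤ) - 1 - 2 * label Λ i) =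
        Finset.univ.val.map fun i => a.getD (label (evenAddOdd Λ) i) 0 := by
      have hsingle : ∀ f : Fin n → ℤ, Finset.univ.val.map f = ∑ i, ({f i} : Multiset ℤ) := by
        intro f
        exact ((Multiset.sum_map_singleton _).symm.trans (by rw [Multiset.map_map]; rfl))
      rw [hsingle, hsingle,
        sum_partSize_label Λ fun d j => ({(d : ℤ) - 1 - 2 * (j : ℤ)} : Multiset ℤ),
        sum_partSize_label (evenAddOdd Λ) fun _ j => ({a.getD j 0} : Multiset ℤ), hparts]
      simp only [← weights_val]
      rw [← coe_evenParts_add_coe_oddParts, Multiset.map_add, Multiset.sum_add, Multiset.map_coe,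
        Multiset.map_coe, Multiset.map_coe, Multiset.sum_coe, Multiset.sum_coe, Multiset.sum_coe,
        ← sum_map_zipPad (by simp [weights]), List.map_map]
      congr 1
      refine List.map_congr_left fun p hp => ?_
      obtain ⟨h1, h2⟩ := haS (S p) (List.mem_map_of_mem hp)
      rw [hcard p hp] at h1 h2
      rw [Function.comp_apply, htake _ h1, h2]
      change _ = (weights p.1 ∪ weights p.2).val
      rw [← Finset.disjUnion_eq_union _ _ (disjoint_weights (hpar p hp).1 (hpar p hp).2)]
      rfl
    exact exists_perm_of_map_univ_eq key

end Weights

/-! ### Orbits of the special linear group -/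

section Orbits

variable {n : ℕ} {K : Type*} [Field K]

theorem mem_adOrbit_self (x : sln n K) : x ∈ adOrbit x :=
  ⟨1, by simp⟩

theorem isConj_of_mem_adOrbit {x y : sln n K} (h : y ∈ adOrbit x) :
    IsConj (x : Matrix (Fin n) (Fin n) K) y := by
  obtain ⟨g, hg⟩ := h
  refine isConj_iff_matrix.2 ⟨(g : Matrix.GeneralLinearGroup (Fin n) K), ?_⟩
  rw [hg, ← map_inv]
  rfl

theorem mem_adOrbit_trans {x y z : sln n K} (h : y ∈ adOrbit x) (h' : z ∈ adOrbit y) :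
    z ∈ adOrbit x := by
  obtain ⟨g, hg⟩ := h
  obtain ⟨g', hg'⟩ := h'
  refine ⟨g' * g, ?_⟩
  rw [hg', hg, mul_inv_rev]
  simp only [Matrix.SpecialLinearGroup.coe_mul, Matrix.mul_assoc]

theorem mem_adOrbit_symm {x y : sln n K} (h : y ∈ adOrbit x) : x ∈ adOrbit y := by
  obtain ⟨g, hg⟩ := h
  refine ⟨g⁻¹, ?_⟩
  have h1 : ((g⁻¹ : Matrix.SpecialLinearGroup (Fin n) K) : Matrix (Fin n) (Fin n) K) * g = 1 := by
    rw [← Matrix.SpecialLinearGroup.coe_mul, inv_mul_cancel, Matrix.SpecialLinearGroup.coe_one]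
  rw [hg, inv_inv, Matrix.mul_assoc, Matrix.mul_assoc, h1, Matrix.mul_one, ← Matrix.mul_assoc, h1,
    Matrix.one_mul]

theorem adOrbit_eq_of_mem {x y : sln n K} (h : y ∈ adOrbit x) : adOrbit y = adOrbit x :=
  Set.Subset.antisymm (fun _ => mem_adOrbit_trans h) fun _ => mem_adOrbit_trans (mem_adOrbit_symm h)

/-- The centralizer of `x` in the general linear group contains elements of every determinant. -/
def CentralizerDetSurjective (x : Matrix (Fin n) (Fin n) K) : Prop :=
  ∀ c : K, c ≠ 0 → ∃ z : Matrix (Fin n) (Fin n) K, z * x = x * z ∧ z.det = c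

theorem CentralizerDetSurjective.of_isConj {x y : Matrix (Fin n) (Fin n) K}
    (hx : CentralizerDetSurjective x) (h : IsConj x y) : CentralizerDetSurjective y := by
  intro c hc
  obtain ⟨z, hz, hdet⟩ := hx c hc
  obtain ⟨g, rfl⟩ := isConj_iff_matrix.1 h
  refine ⟨g * z * (g⁻¹ : Matrix.GeneralLinearGroup (Fin n) K), ?_, ?_⟩
  · have h1 := g.inv_mul
    simp only [Matrix.mul_assoc]
    rw [← Matrix.mul_assoc _ (g : Matrix (Fin n) (Fin n) K), h1, Matrix.one_mul,
      ← Matrix.mul_assoc _ (g : Matrix (Fin n) (Fin n) K), h1, Matrix.one_mul,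
      ← Matrix.mul_assoc z, hz, Matrix.mul_assoc]
  · rw [Matrix.det_units_conj, hdet]

theorem CentralizerDetSurjective.smul {x : Matrix (Fin n) (Fin n) K}
    (hx : CentralizerDetSurjective x) (r : K) : CentralizerDetSurjective (r • x) := by
  intro c hc
  obtain ⟨z, hz, hdet⟩ := hx c hc
  exact ⟨z, by rw [Matrix.mul_smul, hz, Matrix.smul_mul], hdet⟩

/-- A conjugating matrix is corrected to determinant 1 by a centralizing matrix of inverse
determinant. -/
theorem CentralizerDetSurjective.mem_adOrbit {x y : sln n K}
    (hx : CentralizerDetSurjective (x : Matrix (Fin n) (Fin n) K))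
    (h : IsConj (x : Matrix (Fin n) (Fin n) K) y) : y ∈ adOrbit x := by
  obtain ⟨g, hg⟩ := h
  have hdet : (g : Matrix (Fin n) (Fin n) K).det ≠ 0 :=
    ((Matrix.isUnit_iff_isUnit_det _).1 g.isUnit).ne_zero
  obtain ⟨z, hz, hzdet⟩ := hx _ (inv_ne_zero hdet)
  let s : Matrix.SpecialLinearGroup (Fin n) K :=
    ⟨g * z, by rw [Matrix.det_mul, hzdet, mul_inv_cancel₀ hdet]⟩
  refine ⟨s, ?_⟩
  have h1 : (s : Matrix (Fin n) (Fin n) K) * x = y * s := by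
    change (g : Matrix (Fin n) (Fin n) K) * z * x = y * (g * z)
    rw [Matrix.mul_assoc, hz, ← Matrix.mul_assoc, hg.eq, Matrix.mul_assoc]
  rw [h1, Matrix.mul_assoc, ← Matrix.SpecialLinearGroup.coe_mul, mul_inv_cancel,
    Matrix.SpecialLinearGroup.coe_one, Matrix.mul_one]

theorem centralizerDetSurjective_diagonal (hn : 0 < n) (d : Fin n → K) :
    CentralizerDetSurjective (Matrix.diagonal d) := by
  intro c _
  refine ⟨Matrix.diagonal (Function.update 1 ⟨0, hn⟩ c), ?_, ?_⟩
  · rw [Matrix.diagonal_mul_diagonal, Matrix.diagonal_mul_diagonal]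
    simp only [mul_comm]
  · rw [Matrix.det_diagonal, Finset.prod_update_of_mem (Finset.mem_univ _)]
    simp

/-- Scalar matrices suffice, since every complex number is an n-th power. -/
theorem centralizerDetSurjective_complex (hn : 0 < n) (x : Matrix (Fin n) (Fin n) ℂ) :
    CentralizerDetSurjective x := by
  intro c _
  obtain ⟨w, hw⟩ := IsAlgClosed.exists_pow_nat_eq c hn
  refine ⟨w • 1, by simp, ?_⟩
  rw [Matrix.det_smul, Matrix.det_one, Fintype.card_fin, mul_one, hw]

theorem card_blockIndex_eq (Λ : n.Partition) (i : Fin n) :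
    (Finset.univ.filter fun j => blockIndex Λ j = blockIndex Λ i).card = partSize Λ i := by
  rw [← Finset.card_range (partSize Λ i)]
  refine Finset.card_bij (fun j _ => label Λ j) (fun j hj => ?_) (fun j hj k hk h => ?_)
    fun k hk => ?_
  · rw [Finset.mem_range, ← partSize_eq_of_blockIndex_eq Λ (Finset.mem_filter.1 hj).2]
    exact label_lt_partSize Λ j
  · exact eq_of_blockIndex_of_label Λ
      ((Finset.mem_filter.1 hj).2.trans (Finset.mem_filter.1 hk).2.symm) h
  · obtain ⟨j, hj, hj'⟩ := exists_blockIndex_label Λ (Finset.mem_range.1 hk)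
    exact ⟨j, by simp [hj], hj'⟩

theorem centralizerDetSurjective_jordanMat (Λ : n.Partition) {i : Fin n}
    (hi : Odd (partSize Λ i)) : CentralizerDetSurjective (jordanMat Λ ℝ) := by
  have hn : n ≠ 0 := by
    rintro rfl
    exact i.elim0
  have hpos : ∀ c : ℝ, 0 < c → ∃ r : ℝ, r ^ n = c := fun c hc =>
    ⟨c ^ (n⁻¹ : ℝ), Real.rpow_inv_natCast_pow hc.le hn⟩
  intro c hc
  rcases hc.lt_or_gt with hc | hc
  · obtain ⟨r, hr⟩ := hpos (-c) (neg_pos.2 hc)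
    -- Reversing the sign of one block commutes with the Jordan matrix and has determinant -1
    -- because the block is odd; the scalar `r` supplies the absolute value of `c`.
    refine ⟨r • Matrix.diagonal fun j => if blockIndex Λ j = blockIndex Λ i then -1 else 1, ?_, ?_⟩
    · rw [Matrix.smul_mul, Matrix.mul_smul]
      congr 1
      ext j k
      rw [Matrix.diagonal_mul, Matrix.mul_diagonal, jordanMat_apply]
      by_cases h : blockIndex Λ j = blockIndex Λ k ∧ label Λ j + 1 = label Λ k
      · rw [h.1, mul_comm]
      · rw [if_neg h, mul_zero, zero_mul]
    · rw [Matrix.det_smul, Matrix.det_diagonal, Fintype.card_fin, hr, Finset.prod_ite,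
        Finset.prod_const, Finset.prod_const_one, card_blockIndex_eq, hi.neg_one_pow]
      ring
  · obtain ⟨r, hr⟩ := hpos c hc
    refine ⟨r • 1, by simp, ?_⟩
    rw [Matrix.det_smul, Matrix.det_one, Fintype.card_fin, mul_one, hr]

end Orbits

/-! ### Real points of nilpotent orbits and their closures -/

section Closures

variable {n : ℕ} (Λ : n.Partition)

/-- Equal ranks give a real conjugacy with the Jordan matrix, which persists over ℂ, where passing
from GL to SL costs nothing. -/
theorem mem_realPoints_iff (hn : 0 < n) {x : sln n ℝ} : x ∈ realPoints (nilpotentOrbit Λ) ↔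
    ∀ k, ((x : Matrix (Fin n) (Fin n) ℝ) ^ k).rank = labelCount (label Λ) k := by
  constructor
  · intro hx k
    have h1 := rank_eq_of_isConj (isConj_pow (isConj_of_mem_adOrbit hx) k)
    rw [coe_jordanMatrix, rank_jordanMat_pow] at h1
    rw [h1, ← rank_map_algebraMap (L := ℂ), Matrix.map_pow]
    rfl
  · intro hx
    have h1 : IsConj (jordanMat Λ ℝ) x := isConj_of_rank_pow_eq (isNilpotent_jordanMat Λ ℝ)
      fun k => by rw [hx, rank_jordanMat_pow]
    have h2 := (algebraMap ℝ ℂ).mapMatrix.toMonoidHom.map_isConj h1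
    refine (centralizerDetSurjective_complex hn _).mem_adOrbit ?_
    rw [coe_jordanMatrix, ← jordanMat_map Λ ℝ]
    exact h2

theorem isConj_jordanMat (hn : 0 < n) {x : sln n ℝ} (hx : x ∈ realPoints (nilpotentOrbit Λ)) :
    IsConj (jordanMat Λ ℝ) x :=
  isConj_of_rank_pow_eq (isNilpotent_jordanMat Λ ℝ) fun k => by
    rw [(mem_realPoints_iff Λ hn).1 hx, rank_jordanMat_pow]

/-- The real Jordan matrix with blocks of sizes the parts of `Λ`. -/
noncomputable def realJordan : sln n ℝ :=
  ⟨jordanMat Λ ℝ, (mem_sln_iff _).2 <| Finset.sum_eq_zero fun i _ =>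
    isStrict_jordanMat Λ ℝ i i le_rfl⟩

theorem realJordan_mem_realPoints (hn : 0 < n) :
    realJordan Λ ∈ realPoints (nilpotentOrbit Λ) :=
  (mem_realPoints_iff Λ hn).2 fun k => rank_jordanMat_pow Λ ℝ k

/-- If `Λ` has an odd part, the real points of the orbit form a single orbit. -/
theorem realPoints_eq_adOrbit (hn : 0 < n) {i : Fin n} (hi : Odd (partSize Λ i)) {x : sln n ℝ}
    (hx : x ∈ realPoints (nilpotentOrbit Λ)) : realPoints (nilpotentOrbit Λ) = adOrbit x := by
  ext y
  constructor
  · intro hy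
    exact ((centralizerDetSurjective_jordanMat Λ hi).of_isConj
      (isConj_jordanMat Λ hn hx)).mem_adOrbit
      ((isConj_jordanMat Λ hn hx).symm.trans (isConj_jordanMat Λ hn hy))
  · intro hy
    refine (mem_realPoints_iff Λ hn).2 fun k => ?_
    rw [← (mem_realPoints_iff Λ hn).1 hx k]
    exact (rank_eq_of_isConj (isConj_pow (isConj_of_mem_adOrbit hy) k)).symm

theorem realForms_eq_singleton (hn : 0 < n) {i : Fin n} (hi : Odd (partSize Λ i)) {x : sln n ℝ}
    (hx : x ∈ realPoints (nilpotentOrbit Λ)) : realForms (nilpotentOrbit Λ) = {adOrbit x} := by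
  ext R
  rw [Set.mem_singleton_iff]
  constructor
  · rintro ⟨y, hy, rfl⟩
    rw [realPoints_eq_adOrbit Λ hn hi hx] at hy
    exact adOrbit_eq_of_mem hy
  · rintro rfl
    exact ⟨x, hx, rfl⟩

/-- The matrices the ranks of whose powers are at most those of the Jordan matrix of `Λ`. -/
def rankLocus (K : Type*) [Field K] : Set (sln n K) :=
  {x | ∀ k, ((x : Matrix (Fin n) (Fin n) K) ^ k).rank ≤ labelCount (label Λ) k}

theorem continuous_add_smul (x w : sln n ℝ) : Continuous fun t : ℝ => x + t • w := by
  have h : Continuous fun t : ℝ => (x : Matrix (Fin n) (Fin n) ℝ) +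
      t • (w : Matrix (Fin n) (Fin n) ℝ) :=
    continuous_const.add (continuous_id.smul continuous_const)
  exact h.subtype_mk fun t => (x + t • w).2

-- The approximating points lie on the line from `x` to a conjugate `z` of the Jordan matrix. In a
-- suitable basis this line is strictly triangular, which bounds the ranks above; genericity bounds
-- them below.
open Filter Topology in
theorem rankLocus_subset_closure (hn : 0 < n) :
    rankLocus Λ ℝ ⊆ closure (realPoints (nilpotentOrbit Λ)) := by
  intro x hx
  obtain ⟨y, hxy, hy⟩ := exists_isConj_isStrict (antitone_card_label Λ) hx
  obtain ⟨g, hg⟩ := isConj_iff_matrix.1 hxy.symm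
  let z : sln n ℝ := ⟨(g : Matrix (Fin n) (Fin n) ℝ) * jordanMat Λ ℝ *
    (g⁻¹ : Matrix.GeneralLinearGroup (Fin n) ℝ), by
      rw [mem_sln_iff, ← trace_eq_of_isConj (isConj_iff_matrix.2 ⟨g, rfl⟩)]
      exact (mem_sln_iff _).1 (realJordan Λ).2⟩
  have hconj : ∀ t : ℝ, IsConj (y + t • (jordanMat Λ ℝ - y))
      (x + t • (z - x) : sln n ℝ) := by
    intro t
    refine isConj_iff_matrix.2 ⟨g, ?_⟩
    have h1 : ((x + t • (z - x) : sln n ℝ) : Matrix (Fin n) (Fin n) ℝ) =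
        (x : Matrix (Fin n) (Fin n) ℝ) + t • ((g : Matrix (Fin n) (Fin n) ℝ) * jordanMat Λ ℝ *
          (g⁻¹ : Matrix.GeneralLinearGroup (Fin n) ℝ) - x) := rfl
    rw [h1, hg, mul_add, add_mul, Matrix.mul_smul, Matrix.smul_mul, Matrix.mul_sub, Matrix.sub_mul]
  have hstrict : ∀ t : ℝ, IsStrict (label Λ) (y + t • (jordanMat Λ ℝ - y)) := by
    intro t i j hij
    rw [Matrix.add_apply, Matrix.smul_apply, Matrix.sub_apply, hy i j hij,
      isStrict_jordanMat Λ ℝ i j hij]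
    simp
  obtain ⟨s, hs⟩ : ∃ s, ∀ i, label Λ i < s := ⟨Finset.univ.sup (label Λ) + 1,
    fun i => Nat.lt_succ_of_le (Finset.le_sup (Finset.mem_univ i))⟩
  -- Only finitely many exponents need genericity: from `s` on, the label count is zero.
  have hev : ∀ᶠ t in 𝓝[≠] (0 : ℝ), ∀ k ∈ Finset.range s,
      ((jordanMat Λ ℝ) ^ k).rank ≤ ((y + t • (jordanMat Λ ℝ - y)) ^ k).rank :=
    (Filter.eventually_all_finset _).2 fun k _ => eventually_rank_pow_le y (jordanMat Λ ℝ) k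
  have hlim : Tendsto (fun t : ℝ => x + t • (z - x)) (𝓝[≠] 0) (𝓝 x) := by
    have : Tendsto (fun t : ℝ => x + t • (z - x)) (𝓝 0) (𝓝 (x + (0 : ℝ) • (z - x))) :=
      (continuous_add_smul x (z - x)).tendsto 0
    rw [zero_smul, add_zero] at this
    exact this.mono_left nhdsWithin_le_nhds
  refine mem_closure_of_tendsto hlim ?_
  filter_upwards [hev] with t ht
  refine (mem_realPoints_iff Λ hn).2 fun k => ?_
  rw [← rank_eq_of_isConj (isConj_pow (hconj t) k)]
  refine le_antisymm ((hstrict t).rank_pow_le k) ?_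
  by_cases hk : k < s
  · rw [← rank_jordanMat_pow Λ ℝ]
    exact ht k (Finset.mem_range.2 hk)
  · have : labelCount (label Λ) k = 0 := by
      simp only [labelCount, Finset.card_eq_zero, Finset.filter_eq_empty_iff]
      intro i _
      have := hs i
      omega
    rw [this]
    exact Nat.zero_le _

theorem continuous_complexify : Continuous (complexify : sln n ℝ → sln n ℂ) :=
  Continuous.subtype_mk (continuous_subtype_val.matrix_map Complex.continuous_ofReal) _

theorem realPoints_zariskiClosure_subset :
    realPoints (zariskiClosure (nilpotentOrbit Λ)) ⊆ rankLocus Λ ℝ := by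
  intro x hx k
  have h1 := rank_pow_le_of_mem_zariskiClosure (k := k) (r := labelCount (label Λ) k)
    (fun y hy => by
      rw [← rank_eq_of_isConj (isConj_pow (isConj_of_mem_adOrbit hy) k), coe_jordanMatrix,
        rank_jordanMat_pow]) hx
  refine le_trans (le_of_eq ?_) h1
  rw [← rank_map_algebraMap (L := ℂ), Matrix.map_pow]
  rfl

/-- Each of the four sets contains the Euclidean closure of the real points and lies in the rank
locus, and the locus lies in that closure. -/
theorem closures_eq_rankLocus (hn : 0 < n) :
    closure (realPoints (nilpotentOrbit Λ)) = rankLocus Λ ℝ ∧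
    realPoints (closure (nilpotentOrbit Λ)) = rankLocus Λ ℝ ∧
    zariskiClosure (realPoints (nilpotentOrbit Λ)) = rankLocus Λ ℝ ∧
    realPoints (zariskiClosure (nilpotentOrbit Λ)) = rankLocus Λ ℝ := by
  have h1 := rankLocus_subset_closure Λ hn
  have h2 : closure (realPoints (nilpotentOrbit Λ)) ⊆ realPoints (closure (nilpotentOrbit Λ)) :=
    closure_minimal (fun x hx => subset_closure hx)
      (isClosed_closure.preimage continuous_complexify)
  have h3 : realPoints (closure (nilpotentOrbit Λ)) ⊆
      realPoints (zariskiClosure (nilpotentOrbit Λ)) :=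
    fun x hx => closure_subset_zariskiClosure _ hx
  have h4 := realPoints_zariskiClosure_subset Λ
  have h5 := closure_subset_zariskiClosure (realPoints (nilpotentOrbit Λ))
  have h6 : zariskiClosure (realPoints (nilpotentOrbit Λ)) ⊆ rankLocus Λ ℝ := fun x hx k =>
    rank_pow_le_of_mem_zariskiClosure (fun y hy => ((mem_realPoints_iff Λ hn).1 hy k).le) hx
  exact ⟨(h2.trans (h3.trans h4)).antisymm h1, (h3.trans h4).antisymm (h1.trans h2),
    h6.antisymm (h1.trans h5), h4.antisymm (h1.trans (h2.trans h3))⟩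

end Closures

/-! ### Limits of orbits of neutral elements -/

section Limits

variable {n : ℕ}

/-- The product of the matrices `y - c i` for `i < k`. -/
def shiftProd {K : Type*} [Field K] (c : ℕ → K) (y : Matrix (Fin n) (Fin n) K) :
    ℕ → Matrix (Fin n) (Fin n) K
  | 0 => 1
  | k + 1 => shiftProd c y k * (y - c k • 1)

theorem shiftProd_zero {K : Type*} [Field K] (y : Matrix (Fin n) (Fin n) K) (k : ℕ) :
    shiftProd 0 y k = y ^ k := by
  induction k with
  | zero => rfl
  | succ k ih => rw [shiftProd, ih, Pi.zero_apply, zero_smul, sub_zero, pow_succ]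

theorem isConj_shiftProd {K : Type*} [Field K] (c : ℕ → K) {x y : Matrix (Fin n) (Fin n) K}
    (h : IsConj x y) (k : ℕ) : IsConj (shiftProd c x k) (shiftProd c y k) := by
  refine h.imp fun g hg => ?_
  induction k with
  | zero => exact SemiconjBy.one_right _
  | succ k ih =>
    refine ih.mul_right (hg.sub_right ?_)
    rw [SemiconjBy, Matrix.mul_smul, Matrix.smul_mul, Matrix.mul_one, Matrix.one_mul]

theorem shiftProd_diagonal {K : Type*} [Field K] (c : ℕ → K) (d : Fin n → K) (k : ℕ) :
    shiftProd c (Matrix.diagonal d) k =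
      Matrix.diagonal fun i => ∏ j ∈ Finset.range k, (d i - c j) := by
  induction k with
  | zero => simp [shiftProd]
  | succ k ih =>
    rw [shiftProd, ih, ← Matrix.diagonal_one, ← Matrix.diagonal_smul, Matrix.diagonal_sub,
      Matrix.diagonal_mul_diagonal]
    simp [Finset.prod_range_succ]

/-- An index with label below `k` meets its own eigenvalue among the `k` factors. -/
theorem rank_shiftProd_diagonal_le {K : Type*} [Field K] (l : Fin n → ℕ) (c : ℕ → K) (k : ℕ) :
    (shiftProd c (Matrix.diagonal fun i => c (l i)) k).rank ≤ labelCount l k := by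
  classical
  rw [shiftProd_diagonal, Matrix.rank_diagonal, Fintype.card_subtype]
  refine Finset.card_le_card fun i hi => ?_
  rw [Finset.mem_filter] at hi ⊢
  refine ⟨Finset.mem_univ i, ?_⟩
  by_contra! h
  exact hi.2 (Finset.prod_eq_zero (Finset.mem_range.2 h) (sub_self _))

theorem continuous_shiftProd (c : ℕ → ℝ) (k : ℕ) :
    Continuous fun p : ℝ × sln n ℝ =>
      shiftProd (p.1 • c) (p.2 : Matrix (Fin n) (Fin n) ℝ) k := by
  induction k with
  | zero => exact continuous_const
  | succ k ih =>
    refine ih.mul (Continuous.sub (continuous_subtype_val.comp continuous_snd) ?_)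
    exact (continuous_fst.mul continuous_const).smul continuous_const

open Filter Topology in
/-- The limit of the orbits of the multiples of a diagonalizable matrix whose eigenvalues are
numbered by the labels of the Jordan basis of a partition `Λ`. -/
theorem limitOfOrbits_eq_rankLocus (hn : 0 < n) (Λ : n.Partition) {a : ℕ → ℝ} {s : ℕ}
    (hs : ∀ i, label Λ i < s) (ha : Set.InjOn a (Finset.range s)) {h : sln n ℝ}
    (hh : IsConj (Matrix.diagonal fun i => a (label Λ i)) (h : Matrix (Fin n) (Fin n) ℝ)) :
    limitOfOrbits h = rankLocus Λ ℝ := by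
  refine Set.Subset.antisymm (fun x hx k => ?_) fun x hx => ?_
  · by_contra! hr
    -- Semicontinuity is used jointly in the scale and the matrix: at scale 0 the shifted product is
    -- x^k, and at scale ν on the orbit of `ν • h` its rank is already bounded.
    have hopen := (isOpen_setOf_le_rank (labelCount (label Λ) k + 1)).preimage
      (continuous_shiftProd (n := n) a k)
    have hmem : ((0 : ℝ), x) ∈ (fun p : ℝ × sln n ℝ =>
        shiftProd (p.1 • a) (p.2 : Matrix (Fin n) (Fin n) ℝ) k) ⁻¹'
        {A | labelCount (label Λ) k + 1 ≤ A.rank} := by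
      change _ ≤ (shiftProd ((0 : ℝ) • a) _ k).rank
      rw [zero_smul, shiftProd_zero]
      exact hr
    obtain ⟨I, U, hI, hU, h0, hxU, hIU⟩ := isOpen_prod_iff.1 hopen 0 x hmem
    obtain ⟨ε, hε, hεI⟩ := Metric.isOpen_iff.1 hI 0 h0
    have hx' := Set.mem_iInter₂.1 hx ε hε
    obtain ⟨y, hyU, hy⟩ := mem_closure_iff.1 hx' U hU hxU
    obtain ⟨ν, hν, hy⟩ := Set.mem_iUnion₂.1 hy
    have h1 : labelCount (label Λ) k + 1 ≤
        (shiftProd (ν • a) (y : Matrix (Fin n) (Fin n) ℝ) k).rank :=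
      hIU (a := (ν, y)) ⟨hεI (by
        rw [Metric.mem_ball, dist_zero_right, Real.norm_eq_abs, abs_of_pos hν.1]
        exact hν.2), hyU⟩
    have h2 := isConj_shiftProd (ν • a) ((isConj_smul hh ν).trans (isConj_of_mem_adOrbit hy)) k
    rw [← rank_eq_of_isConj h2, ← Matrix.diagonal_smul] at h1
    have h3 := rank_shiftProd_diagonal_le (label Λ) (ν • a) k
    exact absurd (h1.trans h3) (by omega)
  · obtain ⟨y, hxy, hy⟩ := exists_isConj_isStrict (antitone_card_label Λ) hx
    obtain ⟨g, hg⟩ := isConj_iff_matrix.1 hxy.symm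
    let w : sln n ℝ := ⟨(g : Matrix (Fin n) (Fin n) ℝ) * (Matrix.diagonal fun i => a (label Λ i)) *
      (g⁻¹ : Matrix.GeneralLinearGroup (Fin n) ℝ), by
        rw [mem_sln_iff, ← trace_eq_of_isConj (isConj_iff_matrix.2 ⟨g, rfl⟩), trace_eq_of_isConj hh]
        exact (mem_sln_iff _).1 h.2⟩
    -- In the basis where `x` becomes the strict matrix `y`, this is `y` plus ν times the diagonal.
    -- Its blocks carry distinct scalars because ν is nonzero.
    have hmem : ∀ ν : ℝ, 0 < ν → x + ν • w ∈ adOrbit (ν • h) := by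
      intro ν hν
      refine (((centralizerDetSurjective_diagonal hn _).of_isConj hh).smul ν).mem_adOrbit
        ((isConj_smul hh ν).symm.trans ?_)
      have h1 := hy.isConj_add_diagonal hs (a := ν • a) fun i hi j hj hij =>
        ha hi hj (mul_left_cancel₀ hν.ne' hij)
      have h2 : (Matrix.diagonal fun i => (ν • a) (label Λ i)) =
          ν • Matrix.diagonal fun i => a (label Λ i) :=
        Matrix.diagonal_smul ν _
      rw [h2] at h1
      refine h1.trans (isConj_iff_matrix.2 ⟨g, ?_⟩)
      have h3 : ((x + ν • w : sln n ℝ) : Matrix (Fin n) (Fin n) ℝ) =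
          (x : Matrix (Fin n) (Fin n) ℝ) + ν • ((g : Matrix (Fin n) (Fin n) ℝ) *
            (Matrix.diagonal fun i => a (label Λ i)) *
            (g⁻¹ : Matrix.GeneralLinearGroup (Fin n) ℝ)) := rfl
      rw [h3, hg, mul_add, add_mul, Matrix.mul_smul, Matrix.smul_mul]
    have hlim : Tendsto (fun ν : ℝ => x + ν • w) (𝓝[>] 0) (𝓝 x) := by
      have : Tendsto (fun t : ℝ => x + t • w) (𝓝 0) (𝓝 (x + (0 : ℝ) • w)) :=
        (continuous_add_smul x w).tendsto 0
      rw [zero_smul, add_zero] at this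
      exact this.mono_left nhdsWithin_le_nhds
    refine Set.mem_iInter₂.2 fun ε hε => mem_closure_of_tendsto hlim ?_
    filter_upwards [Ioo_mem_nhdsGT hε] with ν hν
    exact Set.mem_iUnion₂.2 ⟨ν, hν, hmem ν hν.1⟩

theorem isConj_diagonal_perm {K : Type*} [Field K] (σ : Equiv.Perm (Fin n)) (d : Fin n → K) :
    IsConj (Matrix.diagonal fun i => d (σ i)) (Matrix.diagonal d) := by
  refine isConj_of_toLin' ⟨(LinearEquiv.funCongrLeft K K σ.symm).toLinearMap,
    (Module.End.isUnit_iff _).2 (LinearEquiv.bijective _), ?_⟩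
  refine LinearMap.ext fun v => funext fun i => ?_
  simp [Matrix.mulVec_diagonal, LinearMap.funLeft_apply]

theorem limitOfOrbits_eq_rankLocus_evenAddOdd (hn : 0 < n) (Λ : n.Partition) {h : sln n ℝ}
    (hh : IsConj (neutralMat Λ ℝ) (h : Matrix (Fin n) (Fin n) ℝ)) :
    limitOfOrbits h = rankLocus (evenAddOdd Λ) ℝ := by
  obtain ⟨a, s, hs, ha, σ, hσ⟩ := exists_labelled_weights Λ
  refine limitOfOrbits_eq_rankLocus hn (evenAddOdd Λ) (a := fun j => (a j : ℝ)) hs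
    (fun i hi j hj hij => ha hi hj (Int.cast_injective hij)) (IsConj.trans ?_ hh)
  have h1 := isConj_diagonal_perm σ fun i => (a (label (evenAddOdd Λ) i) : ℝ)
  refine h1.symm.trans ?_
  rw [neutralMat]
  simp only [hσ]
  exact IsConj.refl _

/-- The commutation relations of a standard triple of traceless matrices. -/
theorem mul_eq_of_isSl2Triple {h e f : sln n ℝ} (t : IsSl2Triple h e f) :
    (h * e : Matrix (Fin n) (Fin n) ℝ) = e * h + 2 * e ∧
      (e * f : Matrix (Fin n) (Fin n) ℝ) = f * e + h := by
  have h1 := congrArg Subtype.val t.lie_h_e_nsmul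
  have h2 := congrArg Subtype.val t.lie_e_f
  rw [LieSubalgebra.coe_bracket, Ring.lie_def, sub_eq_iff_eq_add'] at h1 h2
  refine ⟨h1.trans ?_, h2⟩
  congr 1
  rw [two_mul]
  exact congrArg Subtype.val (two_nsmul e)

/-- The neutral element of a standard triple through a nilpotent element of type `Λ`. -/
theorem isConj_neutralMat (hn : 0 < n) (Λ : n.Partition) {h e f : sln n ℝ}
    (t : IsSl2Triple h e f) (he : e ∈ realPoints (nilpotentOrbit Λ)) :
    IsConj (neutralMat Λ ℝ) (h : Matrix (Fin n) (Fin n) ℝ) := by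
  obtain ⟨h1, h2⟩ := mul_eq_of_isSl2Triple t
  obtain ⟨g, hg⟩ := isConj_iff_matrix.1 (isConj_jordanMat Λ hn he)
  -- Conjugation by `g` moves the explicit Jordan triple to one through `e` itself; the two neutral
  -- elements then belong to the same nilpositive element.
  let φ := MulSemiringAction.toRingHom (ConjAct (Matrix (Fin n) (Fin n) ℝ)ˣ)
    (Matrix (Fin n) (Fin n) ℝ) (ConjAct.toConjAct g)
  have hφ : ∀ x, φ x = (g : Matrix (Fin n) (Fin n) ℝ) * x *
    (g⁻¹ : Matrix.GeneralLinearGroup (Fin n) ℝ) := fun x => rfl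
  have he' : φ (jordanMat Λ ℝ) = e := (hφ _).trans hg.symm
  have h3 := congrArg φ (neutralMat_mul_jordanMat Λ ℝ)
  have h4 := congrArg φ (jordanMat_mul_lowerMat Λ ℝ)
  simp only [map_mul, map_add, he', map_ofNat] at h3 h4
  refine (isConj_iff_matrix.2 ⟨g, hφ _⟩).trans (isConj_neutral h3 h4 h1 h2 ?_)
  rw [← he']
  exact (isNilpotent_jordanMat Λ ℝ).map φ

end Limits

/-! ### Even elements -/

section Even

variable {n : ℕ} (Λ : n.Partition)

theorem partSize_mem_parts (i : Fin n) : partSize Λ i ∈ Λ.parts :=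
  (Multiset.mem_sort (r := (· ≥ ·))).1 (List.get_mem _ _)

theorem exists_partSize_eq {d : ℕ} (hd : d ∈ Λ.parts) : ∃ i, partSize Λ i = d := by
  obtain ⟨k, hk⟩ := List.mem_iff_get.1 ((Multiset.mem_sort (r := (· ≥ ·))).2 hd)
  have hk' : (partsList Λ).get k = d := hk
  refine ⟨blockEquiv Λ ⟨k, ⟨0, by rw [hk']; exact Λ.parts_pos hd⟩⟩, ?_⟩
  rw [partSize, blockIndex, Equiv.symm_apply_apply]
  exact hk'

theorem bracket_coe (h y : sln n ℝ) : ((LieAlgebra.ad ℝ (sln n ℝ) h y : sln n ℝ) :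
    Matrix (Fin n) (Fin n) ℝ) = (h : Matrix (Fin n) (Fin n) ℝ) * y - y * h := by
  rw [LieAlgebra.ad_apply, LieSubalgebra.coe_bracket, Ring.lie_def]

/-- The eigenvalues of `ad h` are the differences of the eigenvalues of `h`. -/
theorem isEvenNeutral_iff {h : sln n ℝ}
    (hh : IsConj (neutralMat Λ ℝ) (h : Matrix (Fin n) (Fin n) ℝ)) :
    IsEvenNeutral h ↔ ∀ i j, (Even (partSize Λ i) ↔ Even (partSize Λ j)) := by
  obtain ⟨g, hg⟩ := hh
  have hu := g.isUnit
  have hginv : (g : Matrix (Fin n) (Fin n) ℝ) * (g⁻¹ : Matrix.GeneralLinearGroup (Fin n) ℝ) = 1 :=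
    g.mul_inv
  have hginv' : ((g⁻¹ : Matrix.GeneralLinearGroup (Fin n) ℝ) : Matrix (Fin n) (Fin n) ℝ) * g = 1 :=
    g.inv_mul
  set wt : Fin n → ℤ := fun i => (partSize Λ i : ℤ) - 1 - 2 * label Λ i with hwt
  have hentry : ∀ (z : Matrix (Fin n) (Fin n) ℝ) (i j : Fin n),
      (neutralMat Λ ℝ * z - z * neutralMat Λ ℝ) i j = ((wt i : ℝ) - wt j) * z i j := by
    intro z i j
    rw [neutralMat, Matrix.sub_apply, Matrix.diagonal_mul, Matrix.mul_diagonal]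
    ring
  constructor
  · intro hev i j
    by_contra hij
    have hne : i ≠ j := fun h => hij (by rw [h])
    -- An off-diagonal matrix unit is traceless and, in an eigenbasis of `h`, an eigenvector whose
    -- eigenvalue is a difference of weights. A weight has parity opposite to its part, so mixed
    -- parts give an odd difference.
    let y₀ : Matrix (Fin n) (Fin n) ℝ := Matrix.single i j 1
    let y : sln n ℝ := ⟨(g : Matrix (Fin n) (Fin n) ℝ) * y₀ *
      (g⁻¹ : Matrix.GeneralLinearGroup (Fin n) ℝ), by
        rw [mem_sln_iff, ← trace_eq_of_isConj (isConj_iff_matrix.2 ⟨g, rfl⟩)]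
        exact Matrix.trace_single_eq_of_ne i j 1 hne⟩
    have hy : (y : Matrix (Fin n) (Fin n) ℝ) * g = g * y₀ := by
      change (g : Matrix (Fin n) (Fin n) ℝ) * y₀ * _ * g = _
      rw [Matrix.mul_assoc, hginv', Matrix.mul_one]
    have hy0 : y ≠ 0 := by
      intro h0
      have h1 : (g : Matrix (Fin n) (Fin n) ℝ) * y₀ = g * 0 := by
        rw [← hy, h0, Matrix.mul_zero]
        exact Matrix.zero_mul _
      have h2 := congrFun (congrFun (hu.mul_left_cancel h1) i) j
      simp [y₀] at h2
    have hbr : LieAlgebra.ad ℝ (sln n ℝ) h y = ((wt i : ℝ) - wt j) • y := by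
      refine Subtype.ext (hu.mul_right_cancel ?_)
      have h3 : ((((wt i : ℝ) - wt j) • y : sln n ℝ) : Matrix (Fin n) (Fin n) ℝ) =
        ((wt i : ℝ) - wt j) • (y : Matrix (Fin n) (Fin n) ℝ) := rfl
      rw [bracket_coe, h3, Matrix.smul_mul, hy, Matrix.sub_mul, Matrix.mul_assoc, hy,
        ← Matrix.mul_assoc, ← hg.eq, Matrix.mul_assoc, Matrix.mul_assoc (y : Matrix (Fin n) (Fin n) ℝ),
        ← hg.eq, ← Matrix.mul_assoc (y : Matrix (Fin n) (Fin n) ℝ), hy, Matrix.mul_assoc,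
        ← Matrix.mul_sub, ← Matrix.mul_smul]
      congr 1
      ext k l
      rw [hentry, Matrix.smul_apply, smul_eq_mul]
      by_cases hkl : i = k ∧ j = l
      · rw [hkl.1, hkl.2]
      · simp [y₀, Matrix.single_apply_of_ne _ _ _ _ _ hkl]
    obtain ⟨k, hk⟩ := hev _ (Module.End.hasEigenvalue_of_hasEigenvector
      ⟨Module.End.mem_eigenspace_iff.2 hbr, hy0⟩)
    have hk' : wt i - wt j = 2 * k := by exact_mod_cast hk
    apply hij
    rw [Nat.even_iff, Nat.even_iff]
    simp only [hwt] at hk'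
    omega
  · intro hev c hc
    obtain ⟨y, hy, hy0⟩ := hc.exists_hasEigenvector
    rw [Module.End.mem_eigenspace_iff] at hy
    have hy' := congrArg Subtype.val hy
    rw [bracket_coe] at hy'
    have h3 : ((c • y : sln n ℝ) : Matrix (Fin n) (Fin n) ℝ) =
      c • (y : Matrix (Fin n) (Fin n) ℝ) := rfl
    rw [h3] at hy'
    obtain ⟨z, hz⟩ : ∃ z : Matrix (Fin n) (Fin n) ℝ, z =
      ((g⁻¹ : Matrix.GeneralLinearGroup (Fin n) ℝ) : Matrix (Fin n) (Fin n) ℝ) * y * g := ⟨_, rfl⟩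
    have hgz : (g : Matrix (Fin n) (Fin n) ℝ) * z = y * g := by
      rw [hz, ← Matrix.mul_assoc, ← Matrix.mul_assoc, hginv, Matrix.one_mul]
    have hzc : neutralMat Λ ℝ * z - z * neutralMat Λ ℝ = c • z := by
      refine hu.mul_left_cancel ?_
      rw [Matrix.mul_smul, hgz, ← Matrix.smul_mul, ← hy', Matrix.mul_sub, ← Matrix.mul_assoc,
        hg.eq, Matrix.mul_assoc, hgz, ← Matrix.mul_assoc, ← Matrix.mul_assoc (g : Matrix (Fin n) (Fin n) ℝ), hgz,
        Matrix.mul_assoc _ _ (neutralMat Λ ℝ), hg.eq, Matrix.sub_mul, ← Matrix.mul_assoc]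
    have hz0 : z ≠ 0 := by
      intro h0
      refine hy0 (Subtype.ext (hu.mul_right_cancel ?_))
      rw [← hgz, h0, Matrix.mul_zero]
      exact (Matrix.zero_mul _).symm
    -- In the eigenbasis of `h`, any nonzero entry of the eigenvector identifies its eigenvalue as a
    -- difference of weights.
    obtain ⟨i, j, hij⟩ : ∃ i j, z i j ≠ 0 := by
      by_contra! h
      exact hz0 (Matrix.ext h)
    have h4 := congrFun (congrFun hzc i) j
    rw [hentry, Matrix.smul_apply, smul_eq_mul] at h4
    have h5 := mul_right_cancel₀ hij h4
    have h6 := hev i j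
    rw [Nat.even_iff, Nat.even_iff] at h6
    obtain ⟨k, hk⟩ : ∃ k, wt i - wt j = 2 * k := by
      refine ⟨(wt i - wt j) / 2, ?_⟩
      simp only [hwt]
      omega
    refine ⟨k, ?_⟩
    rw [← h5]
    exact_mod_cast hk

theorem forall_even_iff_not : (∀ i j, (Even (partSize Λ i) ↔ Even (partSize Λ j))) ↔
    ¬ (evenParts Λ ≠ [] ∧ oddParts Λ ≠ []) := by
  constructor
  · rintro h ⟨h1, h2⟩
    obtain ⟨c, hc⟩ := List.exists_mem_of_ne_nil _ h1
    obtain ⟨d, hd⟩ := List.exists_mem_of_ne_nil _ h2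
    rw [mem_evenParts] at hc
    rw [mem_oddParts] at hd
    obtain ⟨i, rfl⟩ := exists_partSize_eq Λ hc.1
    obtain ⟨j, rfl⟩ := exists_partSize_eq Λ hd.1
    exact Nat.not_even_iff_odd.2 hd.2 ((h i j).1 hc.2)
  · intro h
    have key : ∀ i j, Even (partSize Λ i) → Even (partSize Λ j) := by
      intro i j hi
      by_contra hj
      exact h ⟨List.ne_nil_of_mem ((mem_evenParts Λ).2 ⟨partSize_mem_parts Λ i, hi⟩),
        List.ne_nil_of_mem ((mem_oddParts Λ).2
          ⟨partSize_mem_parts Λ j, Nat.not_even_iff_odd.1 hj⟩)⟩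
    exact fun i j => ⟨key i j, key j i⟩

theorem evenAddOdd_eq_self (h : ¬ (evenParts Λ ≠ [] ∧ oddParts Λ ≠ [])) : evenAddOdd Λ = Λ := by
  have h1 := coe_evenParts_add_coe_oddParts Λ
  refine Nat.Partition.ext ?_
  change ((termwiseAdd (evenParts Λ) (oddParts Λ) : List ℕ) : Multiset ℕ) = Λ.parts
  rcases he : evenParts Λ with _ | ⟨a, l⟩
  · rw [he] at h1
    simpa [termwiseAdd] using h1
  · have ho : oddParts Λ = [] := by
      by_contra ho
      exact h ⟨by rw [he]; simp, ho⟩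
    rw [he, ho] at h1
    rw [ho]
    simpa [termwiseAdd] using h1

/-- The first part of Λ⁰+Λ¹ is the sum of an even and an odd number. -/
theorem exists_odd_partSize_evenAddOdd (h : evenParts Λ ≠ [] ∧ oddParts Λ ≠ []) :
    ∃ i, Odd (partSize (evenAddOdd Λ) i) := by
  obtain ⟨a, l, he⟩ := List.exists_cons_of_ne_nil h.1
  obtain ⟨b, m, ho⟩ := List.exists_cons_of_ne_nil h.2
  obtain ⟨i, hi⟩ := exists_partSize_eq (evenAddOdd Λ) (d := a + b) (by
    change a + b ∈ ((termwiseAdd (evenParts Λ) (oddParts Λ) : List ℕ) : Multiset ℕ)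
    rw [he, ho]
    simp [termwiseAdd])
  refine ⟨i, ?_⟩
  rw [hi]
  exact (even_of_mem_evenParts Λ (by rw [he]; simp)).add_odd
    (odd_of_mem_oddParts Λ (by rw [ho]; simp))

theorem exists_odd_partSize (h : oddParts Λ ≠ []) : ∃ i, Odd (partSize Λ i) := by
  obtain ⟨d, hd⟩ := List.exists_mem_of_ne_nil _ h
  rw [mem_oddParts] at hd
  obtain ⟨i, rfl⟩ := exists_partSize_eq Λ hd.1
  exact ⟨i, hd.2⟩

theorem limitMap_subset_rankLocus (hn : 0 < n) {e : sln n ℝ}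
    (he : e ∈ realPoints (nilpotentOrbit Λ)) (he0 : e ≠ 0) :
    limitMap e ⊆ rankLocus (evenAddOdd Λ) ℝ := by
  intro z hz
  rw [limitMap, if_neg he0] at hz
  obtain ⟨h, f, t, hz⟩ := hz
  rwa [limitOfOrbits_eq_rankLocus_evenAddOdd hn Λ (isConj_neutralMat hn Λ t he)] at hz

/-- The union over all triples through `e` is harmless, as each of them yields the same rank locus.
-/
theorem limitMap_eq_limitOfOrbits (hn : 0 < n) {h e f : sln n ℝ} (t : IsSl2Triple h e f)
    (he : e ∈ realPoints (nilpotentOrbit Λ)) : limitMap e = limitOfOrbits h := by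
  refine Set.Subset.antisymm ?_ fun z hz => ?_
  · rw [limitOfOrbits_eq_rankLocus_evenAddOdd hn Λ (isConj_neutralMat hn Λ t he)]
    exact limitMap_subset_rankLocus Λ hn he t.e_ne_zero
  · rw [limitMap, if_neg t.e_ne_zero]
    exact ⟨h, f, t, hz⟩

theorem limitMapOrbit_adOrbit (hn : 0 < n) {h e f : sln n ℝ} (t : IsSl2Triple h e f)
    (he : e ∈ realPoints (nilpotentOrbit Λ)) :
    limitMapOrbit (adOrbit e) = rankLocus (evenAddOdd Λ) ℝ := by
  refine Set.Subset.antisymm ?_ fun z hz => ⟨e, mem_adOrbit_self e, ?_⟩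
  · rintro z ⟨e', he', hz⟩
    have h0 : e' ≠ 0 := by
      rintro rfl
      obtain ⟨g, hg⟩ := mem_adOrbit_symm he'
      refine t.e_ne_zero (Subtype.ext ?_)
      rw [hg]
      change _ * (0 : Matrix (Fin n) (Fin n) ℝ) * _ = 0
      rw [Matrix.mul_zero, Matrix.zero_mul]
    refine limitMap_subset_rankLocus Λ hn ((mem_realPoints_iff Λ hn).2 fun k => ?_) h0 hz
    rw [← (mem_realPoints_iff Λ hn).1 he k]
    exact (rank_eq_of_isConj (isConj_pow (isConj_of_mem_adOrbit he') k)).symm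
  · rwa [limitMap_eq_limitOfOrbits Λ hn t he,
      limitOfOrbits_eq_rankLocus_evenAddOdd hn Λ (isConj_neutralMat hn Λ t he)]

end Even
end SLOrbit

theorem theorem7p5 (n : ℕ) (h e f : sln n ℝ) (hef : IsSl2Triple h e f)
    (Λ : n.Partition) (hΛ : adOrbit (complexify e) = nilpotentOrbit Λ) :
    limitMap e = limitOfOrbits h ∧
    (IsEvenNeutral h →
      limitMap e = closure (realPoints (nilpotentOrbit Λ)) ∧
      closure (realPoints (nilpotentOrbit Λ)) = realPoints (closure (nilpotentOrbit Λ)) ∧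
      limitMap e = zariskiClosure (realPoints (nilpotentOrbit Λ)) ∧
      zariskiClosure (realPoints (nilpotentOrbit Λ)) =
        realPoints (zariskiClosure (nilpotentOrbit Λ))) ∧
    (¬ IsEvenNeutral h ↔ evenParts Λ ≠ [] ∧ oddParts Λ ≠ []) ∧
    (¬ IsEvenNeutral h →
      realForms (nilpotentOrbit Λ) = {adOrbit e} ∧
      ∃ R : Set (sln n ℝ), realForms (nilpotentOrbit (evenAddOdd Λ)) = {R} ∧
        limitMapOrbit (adOrbit e) = closure R ∧
        limitMapOrbit (adOrbit e) = zariskiClosure R) := by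
  have hn : 0 < n := by
    rcases n.eq_zero_or_pos with rfl | hn
    · exact absurd (Subtype.ext (Matrix.ext fun i => i.elim0)) hef.h_ne_zero
    · exact hn
  have he : e ∈ realPoints (nilpotentOrbit Λ) := by
    change complexify e ∈ nilpotentOrbit Λ
    rw [← hΛ]
    exact mem_adOrbit_self _
  have hconj := isConj_neutralMat hn Λ hef he
  have hlim := limitMap_eq_limitOfOrbits Λ hn hef he
  have hlocus := hlim.trans (limitOfOrbits_eq_rankLocus_evenAddOdd hn Λ hconj)
  have heven : IsEvenNeutral h ↔ ¬ (evenParts Λ ≠ [] ∧ oddParts Λ ≠ []) :=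
    (isEvenNeutral_iff Λ hconj).trans (forall_even_iff_not Λ)
  have hodd : ¬ IsEvenNeutral h ↔ evenParts Λ ≠ [] ∧ oddParts Λ ≠ [] := by
    rw [heven, not_not]
  refine ⟨hlim, fun hev => ?_, hodd, fun hev => ?_⟩
  · rw [evenAddOdd_eq_self Λ (heven.1 hev)] at hlocus
    obtain ⟨h1, h2, h3, h4⟩ := closures_eq_rankLocus Λ hn
    exact ⟨hlocus.trans h1.symm, h1.trans h2.symm, hlocus.trans h3.symm, h3.trans h4.symm⟩
  · have hparts := hodd.1 hev
    -- An odd part of Λ and an odd part of Λ⁰+Λ¹ give the uniqueness of the respective real forms.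
    obtain ⟨i, hi⟩ := exists_odd_partSize Λ hparts.2
    obtain ⟨j, hj⟩ := exists_odd_partSize_evenAddOdd Λ hparts
    have hJ := realJordan_mem_realPoints (evenAddOdd Λ) hn
    obtain ⟨h1, -, h3, -⟩ := closures_eq_rankLocus (evenAddOdd Λ) hn
    rw [realPoints_eq_adOrbit _ hn hj hJ] at h1 h3
    have h5 := limitMapOrbit_adOrbit Λ hn hef he
    exact ⟨realForms_eq_singleton Λ hn hi he, _, realForms_eq_singleton _ hn hj hJ,
      h5.trans h1.symm, h5.trans h3.symm⟩
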